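/- Let $c\ge 0$, $\kappa\in\mathbb R$. Let $\mathcal X(\mathbb R)=\{v\in H^1_{\rm loc}(\mathbb R;\mathbb C): 1-|v|^2\in L^2(\mathbb R),\ v'\in L^2(\mathbb R)\}$, and let $u\in\mathcal X(\mathbb R)$ be a weak solution of $$icu'+u''+u(1-|u|^2)+\kappa u(1-|u|^2)''=0\quad\text{in }\mathbb R,$$ that is, with $\langle z,w\rangle=\operatorname{Re}z\operatorname{Re}w+\operatorname{Im}z\operatorname{Im}w$, for all $\phi\in C_0^\infty(\mathbb R;\mathbb C)$, $$\int_{\mathbb R}\langle icu'+u(1-|u|^2),\phi\rangle-\langle u',\phi'\rangle+2\kappa\langle u,u'\rangle\langle u,\phi\rangle'\,dx=0 .$$ Set $\mathcal D_1=\{0\le c<\sqrt2,\ 0<\kappa<1/2\}$, $\mathcal D_2=\{0\le c<\sqrt2,\ \kappa\le 0\}$, $\mathcal D_3=\{c>\sqrt2,\ \kappa>1/2\}$, $\mathcal B_-=\{c=\sqrt2,\ 0<\kappa<1/2\}$, $\mathcal B_+=\{c=\sqrt2,\ \kappa>1/2\}$, $\mathcal C=\{c\ge0,\ \kappa=1/2\}$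 (sets of pairs $(c,\kappa)$) and $\tilde{\mathcal D}=\mathcal D_1\cup\mathcal D_3\cup\mathcal B_-\cup\mathcal B_+$. Assume that $(c,\kappa)\notin\tilde{\mathcal D}\cup\mathcal C$. Then, up to modification on a null set, one of the following holds. 1. $(c,\kappa)\in\mathcal D_2$, $u\in C^\infty(\mathbb R)$, and there are $x_0,\varphi\in\mathbb R$ such that $u(x)=e^{i\varphi}u_{c,\kappa}(x-x_0)$ for all $x\in\mathbb R$. Here the function $$G_{c,\kappa}(y)=-2\sqrt{-\kappa}\,\operatorname{atanh}\Big(\sqrt{-\kappa}\sqrt{\tfrac{2-c^2-2y}{1-2\kappa+2\kappa y}}\Big)+2\sqrt{\tfrac{1-2\kappa}{2-c^2}}\,\operatorname{atanh}\Big(\sqrt{\tfrac{(1-2\kappa)(2-c^2-2y)}{(2-c^2)(1-2\kappa+2\kappa y)}}\Big)$$ is a bijection from $(0,1-c^2/2]$ onto $[0,\infty)$, $\eta_{c,\kappa}(x)=G_{c,\kappa}^{-1}(|x|)$ for $x\in\mathbb R$, and the soliton is $$u_{c,\kappa}(x)=\sqrt{1-\eta_{c,\kappa}(x)}\,e^{i\theta_{c,\kappa}(x)},\qquad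 \theta_{c,\kappa}(x)=\frac c2\int_0^x\frac{\eta_{c,\kappa}(y)}{1-\eta_{c,\kappa}(y)}\,dy\qquad\text{if }c>0,$$ and $u_{0,\kappa}(x)=\pm\sqrt{1-\eta_{0,\kappa}(x)}$ for $\pm x\ge0$ if $c=0$. 2. $u$ is constant, equal to a complex number of modulus one. -/

import Mathlib

open scoped ContDiff

namespace QGP

open MeasureTheory Set

noncomputable section

/-! ## Weak derivatives, the energy space and weak solutions -/

/-- `g` is the weak (distributional) derivative on `ℝ` of the complex-valued function `v`. -/
def HasWeakDeriv (v g : ℝ → ℂ) : Prop :=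
  LocallyIntegrable v volume ∧ LocallyIntegrable g volume ∧
    ∀ ψ : ℝ → ℝ, ContDiff ℝ ∞ ψ → HasCompactSupport ψ →
      ∫ x, deriv ψ x • v x = -∫ x, ψ x • g x

/-- `L²_loc(ℝ; ℂ)`. -/
def L2loc : Set (ℝ → ℂ) :=
  {v | ∀ K : Set ℝ, IsCompact K → MemLp v 2 (volume.restrict K)}

/-- `H¹_loc(ℝ; ℂ)`. -/
def H1loc : Set (ℝ → ℂ) :=
  {v | v ∈ L2loc ∧ ∃ g ∈ L2loc, HasWeakDeriv v g}

/-- The energy space `X(ℝ) = {v ∈ H¹_loc(ℝ) : 1 - |v|² ∈ L²(ℝ), v' ∈ L²(ℝ)}`. Its elements are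
functions defined up to equality almost everywhere; no continuity is imposed. -/
def EnergySpace : Set (ℝ → ℂ) :=
  {v | v ∈ H1loc ∧ MemLp (fun x => 1 - ‖v x‖ ^ 2) 2 volume ∧
    ∃ g : ℝ → ℂ, HasWeakDeriv v g ∧ MemLp g 2 volume}

/-- `u` is a weak solution of `i c u' + u'' + u (1 - |u|²) + κ u (1 - |u|²)'' = 0`, that is,
`∫ ⟨i c u' + u (1 - |u|²), φ⟩ - ⟨u', φ'⟩ + 2 κ ⟨u, u'⟩ ⟨u, φ⟩' = 0` for all
`φ ∈ C₀^∞(ℝ; ℂ)`. Here `⟨z, w⟩ = Re z Re w + Im z Im w`, `g` is the weak derivative `u'`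
(unique up to null sets), and `⟨u, φ⟩' = ⟨u', φ⟩ + ⟨u, φ'⟩`. -/
def IsWeakSolution (c κ : ℝ) (u : ℝ → ℂ) : Prop :=
  ∃ g : ℝ → ℂ, HasWeakDeriv u g ∧
    ∀ φ : ℝ → ℂ, ContDiff ℝ ∞ φ → HasCompactSupport φ →
      ∫ x, (inner ℝ (Complex.I * (c : ℂ) * g x + u x * ((1 - ‖u x‖ ^ 2 : ℝ) : ℂ)) (φ x)
          - inner ℝ (g x) (deriv φ x)
          + 2 * κ * inner ℝ (u x) (g x)
              * (inner ℝ (g x) (φ x) + inner ℝ (u x) (deriv φ x))) = 0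

/-! ## Parameter regions (pairs `(c, κ)`) -/

def D1 : Set (ℝ × ℝ) := {p | 0 ≤ p.1 ∧ p.1 < √2 ∧ 0 < p.2 ∧ p.2 < 1 / 2}

def D2 : Set (ℝ × ℝ) := {p | 0 ≤ p.1 ∧ p.1 < √2 ∧ p.2 ≤ 0}

def D3 : Set (ℝ × ℝ) := {p | √2 < p.1 ∧ 1 / 2 < p.2}

def Bminus : Set (ℝ × ℝ) := {p | p.1 = √2 ∧ 0 < p.2 ∧ p.2 < 1 / 2}

def Bplus : Set (ℝ × ℝ) := {p | p.1 = √2 ∧ 1 / 2 < p.2}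

def Dtilde : Set (ℝ × ℝ) := D1 ∪ D3 ∪ Bminus ∪ Bplus

def Ccrit : Set (ℝ × ℝ) := {p | 0 ≤ p.1 ∧ p.2 = 1 / 2}

/-! ## The explicit dark soliton for `(c, κ) ∈ D2` -/

/-- The interval `(0, 1 - c²/2]`. -/
def Ic (c : ℝ) : Set ℝ := Ioc 0 (1 - c ^ 2 / 2)

/-- The function `G_{c,κ}`, to be used on `Ic c` for `(c, κ) ∈ D2`. -/
def G (c κ y : ℝ) : ℝ :=
  -2 * √(-κ) * Real.artanh (√(-κ) * √((2 - c ^ 2 - 2 * y) / (1 - 2 * κ + 2 * κ * y)))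
    + 2 * √((1 - 2 * κ) / (2 - c ^ 2))
      * Real.artanh (√(((1 - 2 * κ) * (2 - c ^ 2 - 2 * y))
          / ((2 - c ^ 2) * (1 - 2 * κ + 2 * κ * y))))

/-- The intensity profile `η_{c,κ}`: the even extension to `ℝ` of the inverse of
`G_{c,κ} : (0, 1 - c²/2] → [0, ∞)`. -/
def eta (c κ x : ℝ) : ℝ := Function.invFunOn (G c κ) (Ic c) |x|

/-- The phase `θ_{c,κ}(x) = (c/2) ∫₀ˣ η_{c,κ} / (1 - η_{c,κ})`. -/
def theta (c κ x : ℝ) : ℝ := c / 2 * ∫ y in (0 : ℝ)..x, eta c κ y / (1 - eta c κ y)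

/-- The dark soliton `u_{c,κ}`: for `c ≠ 0` it is `√(1 - η_{c,κ}) e^{i θ_{c,κ}}`, and for
`c = 0` it is the real odd function equal to `±√(1 - η_{0,κ}(x))` for `±x ≥ 0` (the black
soliton; `η_{0,κ}(0) = 1`). -/
def soliton (c κ x : ℝ) : ℂ :=
  if c = 0 then
    (if 0 ≤ x then ((√(1 - eta 0 κ x) : ℝ) : ℂ) else ((-√(1 - eta 0 κ x) : ℝ) : ℂ))
  else ((√(1 - eta c κ x) : ℝ) : ℂ) * Complex.exp (Complex.I * (theta c κ x : ℂ))

end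

end QGP

/-!
In terms of the flux `F = U' - 2κ⟨U, U'⟩U` the equation is a first-order system, which is regular
wherever `2κ|U|² ≠ 1`. Since `1 - |U|²` and `U'` are square integrable, the angular momentum
`⟨iU, U'⟩ - (c/2)(1 - |U|²)` and the energy `|U'|² - 2κ⟨U, U'⟩² - (1 - |U|²)²/2`, which are
conserved, vanish. Together they give, for the deficit `η = 1 - |U|²`,
`(η')² (1 - 2κ + 2κη) = η² (2 - c² - 2η)`. If `(1 - 2κ)(2 - c²) < 0`, the two sides have opposite
signs for small `η ≠ 0`; as `η → 0` at infinity, `η ≡ 0` and `U` is constant. Otherwise the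
assumption on the parameters leaves `κ ≤ 0`, and a nonzero `η` takes the value `1 - c²/2` at the
point `x₀` where `|η|` is maximal, is decreasing on both sides of it, and `G(η(x)) = |x - x₀|`
because `G` is the primitive of `-1/(η √((2 - c² - 2η)/(1 - 2κ + 2κη)))`. The phase is then
recovered from the vanishing angular momentum.
-/

namespace QGP

open MeasureTheory Set Filter Topology
open scoped InnerProductSpace

section WeakDerivative

variable {E : Type*} [NormedAddCommGroup E]

theorem intervalIntegrable_of_locallyIntegrable {f : ℝ → E} (hf : LocallyIntegrable f volume)
    (a b : ℝ) : IntervalIntegrable f volume a b :=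
  (hf.integrableOn_isCompact isCompact_uIcc).intervalIntegrable

theorem exists_tsupport_subset_Ioo {ψ : ℝ → ℝ} (hc : HasCompactSupport ψ) :
    ∃ R, 0 < R ∧ tsupport ψ ⊆ Ioo (-R) R := by
  obtain ⟨R, hR, h⟩ := hc.isCompact.isBounded.subset_ball_lt 0 0
  exact ⟨R, hR, by rwa [Real.ball_eq_Ioo, zero_sub, zero_add] at h⟩

theorem integral_deriv_mul_primitive {h ψ : ℝ → ℝ} (hh : LocallyIntegrable h volume)
    (hψ : ContDiff ℝ 1 ψ) (hc : HasCompactSupport ψ) :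
    ∫ x, deriv ψ x * ∫ t in (0 : ℝ)..x, h t = -∫ x, ψ x * h x := by
  obtain ⟨R, hR0, hR⟩ := exists_tsupport_subset_Ioo hc
  have hsupp : tsupport ψ ⊆ Ioc (-R) R := hR.trans Ioo_subset_Ioc_self
  have hψR : ψ R = 0 := image_eq_zero_of_notMem_tsupport fun h => lt_irrefl _ (hR h).2
  have hψR' : ψ (-R) = 0 := image_eq_zero_of_notMem_tsupport fun h => lt_irrefl _ (hR h).1
  have acψ : AbsolutelyContinuousOnInterval ψ (-R) R := by
    obtain ⟨C, hC⟩ := hψ.lipschitzWith_of_hasCompactSupport hc one_ne_zero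
    exact hC.lipschitzOnWith.absolutelyContinuousOnInterval
  have acH : AbsolutelyContinuousOnInterval (fun x => ∫ t in (0 : ℝ)..x, h t) (-R) R :=
    (intervalIntegrable_of_locallyIntegrable hh _ _).absolutelyContinuousOnInterval_intervalIntegral
      (by rw [uIcc_of_le (by linarith)]; constructor <;> linarith)
  have parts := AbsolutelyContinuousOnInterval.integral_mul_deriv_eq_deriv_mul acψ acH
  rw [hψR, hψR', zero_mul, zero_mul, sub_zero, zero_sub] at parts
  calc ∫ x, deriv ψ x * ∫ t in (0 : ℝ)..x, h t
      = ∫ x in (-R)..R, deriv ψ x * ∫ t in (0 : ℝ)..x, h t :=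
        (intervalIntegral.integral_eq_integral_of_support_subset <|
          (Function.support_mul_subset_left _ _).trans (support_deriv_subset.trans hsupp)).symm
    _ = -∫ x in (-R)..R, ψ x * deriv (fun x => ∫ t in (0 : ℝ)..x, h t) x := by
        rw [parts, neg_neg]
    _ = -∫ x in (-R)..R, ψ x * h x := by
        congr 1
        apply intervalIntegral.integral_congr_ae
        filter_upwards [LocallyIntegrable.ae_hasDerivAt_integral hh] with x hx _
        rw [(hx 0).deriv]
    _ = -∫ x, ψ x * h x := by
        rw [intervalIntegral.integral_eq_integral_of_support_subset <|
          (Function.support_mul_subset_left _ _).trans ((subset_tsupport ψ).trans hsupp)]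

theorem exists_contDiff_hasCompactSupport_deriv_eq {f : ℝ → ℝ} (hf : ContDiff ℝ ∞ f)
    (hc : HasCompactSupport f) (h0 : ∫ x, f x = 0) :
    ∃ ψ : ℝ → ℝ, ContDiff ℝ ∞ ψ ∧ HasCompactSupport ψ ∧ deriv ψ = f := by
  obtain ⟨R, -, hR⟩ := exists_tsupport_subset_Ioo hc
  have hψ (x : ℝ) : HasDerivAt (fun x => ∫ t in (-R)..x, f t) (f x) x :=
    hf.continuous.integral_hasStrictDerivAt (-R) x |>.hasDerivAt
  have hderiv : deriv (fun x => ∫ t in (-R)..x, f t) = f := funext fun x => (hψ x).deriv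
  refine ⟨fun x => ∫ t in (-R)..x, f t, ?_, ?_, hderiv⟩
  · rw [contDiff_infty_iff_deriv, hderiv]
    exact ⟨fun x => (hψ x).differentiableAt, hf⟩
  · refine HasCompactSupport.intro (isCompact_Icc : IsCompact (Icc (-R) R)) fun x hx => ?_
    rcases lt_or_ge x (-R) with hxR | hxR
    · have hzero : EqOn f 0 (uIcc (-R) x) := fun t ht => by
        rw [uIcc_of_ge hxR.le] at ht
        exact image_eq_zero_of_notMem_tsupport fun h => (hR h).1.not_ge ht.2
      simp [intervalIntegral.integral_congr hzero]
    · have hRx : R < x := lt_of_not_ge fun h => hx ⟨hxR, h⟩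
      rw [intervalIntegral.integral_eq_integral_of_support_subset, h0]
      exact (subset_tsupport f).trans fun t ht => ⟨(hR ht).1, (hR ht).2.le.trans hRx.le⟩

variable [NormedSpace ℝ E]

theorem exists_ae_eq_const [CompleteSpace E] {w : ℝ → E} (hw : LocallyIntegrable w volume)
    (h : ∀ ψ : ℝ → ℝ, ContDiff ℝ ∞ ψ → HasCompactSupport ψ → ∫ x, deriv ψ x • w x = 0) :
    ∃ C : E, ∀ᵐ x, w x = C := by
  let b : ContDiffBump (0 : ℝ) := ⟨1, 2, one_pos, one_lt_two⟩
  let φ₀ : ℝ → ℝ := b.normed volume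
  have hφ₀ : ContDiff ℝ ∞ φ₀ := b.contDiff_normed
  have hφ₀c : HasCompactSupport φ₀ := b.hasCompactSupport_normed
  have hφ₀i : ∫ x, φ₀ x = 1 := b.integral_normed
  refine ⟨∫ x, φ₀ x • w x,
    ae_eq_of_integral_contDiff_smul_eq hw (locallyIntegrable_const _) fun φ hφ hc => ?_⟩
  -- Subtracting the multiple `m φ₀` of the bump leaves a function of integral zero.
  let m := ∫ x, φ x
  obtain ⟨ψ, hψ, hψc, hderiv⟩ := exists_contDiff_hasCompactSupport_deriv_eq
    (f := fun x => φ x - m * φ₀ x) (hφ.sub (contDiff_const.mul hφ₀)) (hc.sub hφ₀c.mul_left) (by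
      rw [integral_sub (hφ.continuous.integrable_of_hasCompactSupport hc)
        ((hφ₀.continuous.integrable_of_hasCompactSupport hφ₀c).const_mul m),
        integral_const_mul, hφ₀i, mul_one, sub_self])
  have hzero : ∫ x, (φ x • w x - m • φ₀ x • w x) = 0 := by
    simpa only [hderiv, sub_smul, mul_smul] using h ψ hψ hψc
  have hi := hw.integrable_smul_left_of_hasCompactSupport hφ.continuous hc
  have hi₀ : Integrable (fun x => m • φ₀ x • w x) :=
    (hw.integrable_smul_left_of_hasCompactSupport hφ₀.continuous hφ₀c).smul m
  rw [integral_sub hi hi₀, integral_smul, sub_eq_zero] at hzero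
  rw [hzero, integral_smul_const]

theorem continuous_primitive_of_locallyIntegrable {g : ℝ → E} (hg : LocallyIntegrable g volume) :
    Continuous fun x => ∫ t in (0 : ℝ)..x, g t :=
  intervalIntegral.continuous_primitive (intervalIntegrable_of_locallyIntegrable hg) 0

theorem integral_deriv_smul_primitive [CompleteSpace E] {g : ℝ → E}
    (hg : LocallyIntegrable g volume) {ψ : ℝ → ℝ} (hψ : ContDiff ℝ 1 ψ)
    (hc : HasCompactSupport ψ) :
    ∫ x, deriv ψ x • ∫ t in (0 : ℝ)..x, g t = -∫ x, ψ x • g x := by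
  have hi := (continuous_primitive_of_locallyIntegrable hg).locallyIntegrable
    |>.integrable_smul_left_of_hasCompactSupport (μ := volume) (hψ.continuous_deriv le_rfl) hc.deriv
  have hi' := hg.integrable_smul_left_of_hasCompactSupport hψ.continuous hc
  refine SeparatingDual.eq_iff_forall_dual_eq (R := ℝ) |>.2 fun L => ?_
  have hL : LocallyIntegrable (fun x => L (g x)) volume := fun x =>
    (hg x).imp fun s hs => ⟨hs.1, L.integrable_comp hs.2⟩
  rw [map_neg, ← L.integral_comp_comm hi, ← L.integral_comp_comm hi']
  simp only [map_smul, smul_eq_mul,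
    ← L.intervalIntegral_comp_comm (intervalIntegrable_of_locallyIntegrable hg 0 _)]
  exact integral_deriv_mul_primitive hL hψ hc

theorem HasWeakDeriv.exists_ae_eq_primitive {v g : ℝ → ℂ} (h : HasWeakDeriv v g) :
    ∃ C : ℂ, ∀ᵐ x, v x = C + ∫ t in (0 : ℝ)..x, g t := by
  obtain ⟨hv, hg, hvg⟩ := h
  have hG : LocallyIntegrable (fun x => ∫ t in (0 : ℝ)..x, g t) volume :=
    (continuous_primitive_of_locallyIntegrable hg).locallyIntegrable
  obtain ⟨C, hC⟩ := exists_ae_eq_const (hv.sub hG) fun ψ hψ hc => by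
    have hψ1 : ContDiff ℝ 1 ψ := hψ.of_le (by simp)
    have hdc : Continuous (deriv ψ) := hψ1.continuous_deriv le_rfl
    simp only [Pi.sub_apply, smul_sub]
    rw [integral_sub (hv.integrable_smul_left_of_hasCompactSupport hdc hc.deriv)
      (hG.integrable_smul_left_of_hasCompactSupport hdc hc.deriv), hvg ψ hψ hc,
      integral_deriv_smul_primitive hg hψ1 hc, sub_self]
  exact ⟨C, hC.mono fun x hx => sub_eq_iff_eq_add.1 hx⟩

theorem HasWeakDeriv.ae_unique {v g g' : ℝ → ℂ} (h : HasWeakDeriv v g) (h' : HasWeakDeriv v g') :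
    g =ᵐ[volume] g' :=
  ae_eq_of_integral_contDiff_smul_eq h.2.1 h'.2.1 fun ψ hψ hc =>
    neg_injective ((h.2.2 ψ hψ hc).symm.trans (h'.2.2 ψ hψ hc))

end WeakDerivative

section Decay

variable {E : Type*} [NormedAddCommGroup E]

theorem tendsto_integral_window [NormedSpace ℝ E] {f : ℝ → E} (hf : Integrable f volume) {a : ℝ}
    (ha : 0 ≤ a) : Tendsto (fun x => ∫ t in x..x + a, f t) (cocompact ℝ) (𝓝 0) := by
  have hwindow (x : ℝ) : ∫ t in x..x + a, f t = ∫ t, (Ioc x (x + a)).indicator f t := by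
    rw [intervalIntegral.integral_of_le (by linarith), integral_indicator measurableSet_Ioc]
  have hout (t : ℝ) : ∀ᶠ x in atBot ⊔ atTop, (Ioc x (x + a)).indicator f t = 0 := by
    refine eventually_sup.2 ⟨?_, ?_⟩
    · filter_upwards [eventually_lt_atBot (t - a)] with x hx
      exact indicator_of_notMem (fun h => by linarith [h.2]) _
    · filter_upwards [eventually_ge_atTop t] with x hx
      exact indicator_of_notMem (fun h => by linarith [h.1]) _
  simp only [hwindow]
  rw [cocompact_eq_atBot_atTop, ← integral_zero (α := ℝ) (G := E) (μ := volume)]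
  refine tendsto_integral_filter_of_dominated_convergence (fun t => ‖f t‖)
    (.of_forall fun x => (hf.indicator measurableSet_Ioc).aestronglyMeasurable)
    (.of_forall fun x => .of_forall fun t => norm_indicator_le_norm_self _ _) hf.norm
    (.of_forall fun t => tendsto_const_nhds.congr' ((hout t).mono fun x hx => hx.symm))

theorem tendsto_zero_of_uniformContinuous_of_integrable_norm_pow {f : ℝ → E} {n : ℕ}
    (huc : UniformContinuous f) (hf : Integrable (fun x => ‖f x‖ ^ n) volume) :
    Tendsto f (cocompact ℝ) (𝓝 0) := by
  rw [Metric.tendsto_nhds]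
  intro ε hε
  obtain ⟨δ, hδ, hfδ⟩ := Metric.uniformContinuous_iff.1 huc (ε / 2) (half_pos hε)
  have hsmall := (tendsto_integral_window hf (half_pos hδ).le).eventually_lt_const
    (show (0 : ℝ) < δ / 2 * (ε / 2) ^ n by positivity)
  filter_upwards [hsmall] with x hx
  rw [dist_zero_right]
  by_contra! hfx
  have hwindow (t : ℝ) (ht : t ∈ Icc x (x + δ / 2)) : (ε / 2) ^ n ≤ ‖f t‖ ^ n := by
    have hdist : ‖f x - f t‖ < ε / 2 := by
      rw [← dist_eq_norm]
      refine hfδ ?_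
      rw [Real.dist_eq, abs_lt]
      constructor <;> linarith [ht.1, ht.2]
    gcongr
    linarith [norm_le_norm_add_norm_sub (f t) (f x), norm_sub_rev (f t) (f x)]
  have hint := intervalIntegral.integral_mono_on (μ := volume) (by linarith : x ≤ x + δ / 2)
    intervalIntegrable_const hf.intervalIntegrable hwindow
  rw [intervalIntegral.integral_const, add_sub_cancel_left, smul_eq_mul] at hint
  linarith

theorem holderWith_primitive_of_memLp [NormedSpace ℝ E] {g : ℝ → E} {p : ENNReal} (hp : 1 ≤ p)
    (hg : MemLp g p volume) :
    HolderWith (eLpNorm g p volume).toNNReal (1 - 1 / p.toReal).toNNReal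
      fun x => ∫ t in (0 : ℝ)..x, g t := by
  have hint := intervalIntegrable_of_locallyIntegrable (hg.locallyIntegrable hp)
  have hexp : 0 ≤ 1 - 1 / p.toReal := by
    rcases eq_or_ne p ⊤ with rfl | hp'
    · simp
    · have : 1 ≤ p.toReal := by simpa using ENNReal.toReal_mono hp' hp
      rw [sub_nonneg, div_le_one (by linarith)]
      exact this
  intro x y
  rw [ENNReal.coe_toNNReal hg.eLpNorm_ne_top, Real.coe_toNNReal _ hexp, edist_eq_enorm_sub,
    intervalIntegral.integral_interval_sub_left (hint 0 x) (hint 0 y), edist_comm, ← enorm_neg,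
    ← intervalIntegral.integral_symm]
  calc ‖∫ t in x..y, g t‖ₑ ≤ ∫⁻ t in uIoc x y, ‖g t‖ₑ :=
        (enorm_le_iff_norm_le.2
          (intervalIntegral.norm_integral_eq_norm_integral_uIoc g).le).trans
            (enorm_integral_le_lintegral_enorm g)
    _ = eLpNorm g 1 (volume.restrict (uIoc x y)) := eLpNorm_one_eq_lintegral_enorm.symm
    _ ≤ eLpNorm g p (volume.restrict (uIoc x y))
          * volume.restrict (uIoc x y) univ ^ (1 / ENNReal.toReal 1 - 1 / p.toReal) :=
        eLpNorm_le_eLpNorm_mul_rpow_measure_univ hp hg.1.restrict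
    _ ≤ eLpNorm g p volume * edist y x ^ (1 - 1 / p.toReal) := by
        rw [Measure.restrict_apply_univ, ENNReal.toReal_one, div_one, Real.volume_uIoc, edist_dist,
          Real.dist_eq]
        gcongr
        exact Measure.restrict_le_self

end Decay

section Integrability

variable {E F : Type*} [NormedAddCommGroup E] [NormedAddCommGroup F]

theorem locallyIntegrable_continuous_smul [NormedSpace ℝ E] {a : ℝ → ℝ} {f : ℝ → E}
    (ha : Continuous a) (hf : LocallyIntegrable f volume) :
    LocallyIntegrable (fun x => a x • f x) volume :=
  locallyIntegrableOn_univ.1 <| (hf.locallyIntegrableOn univ).continuousOn_smul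
    isOpen_univ.isLocallyClosed ha.continuousOn

theorem locallyIntegrable_inner_smul [InnerProductSpace ℝ E] [NormedSpace ℝ F] {U g : ℝ → E}
    {v : ℝ → F} (hU : Continuous U) (hg : AEStronglyMeasurable g volume)
    (hv : AEStronglyMeasurable v volume)
    (hgv : LocallyIntegrable (fun x => ‖g x‖ * ‖v x‖) volume) (a : ℝ) :
    LocallyIntegrable (fun x => (a * ⟪U x, g x⟫_ℝ) • v x) volume := by
  have hbound := locallyIntegrable_continuous_smul (continuous_const.mul hU.norm : Continuous
    fun x => |a| * ‖U x‖) hgv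
  refine hbound.mono (((hU.aestronglyMeasurable.inner hg).const_mul a).smul hv)
    (.of_forall fun x => ?_)
  calc ‖(a * ⟪U x, g x⟫_ℝ) • v x‖ = |a| * |⟪U x, g x⟫_ℝ| * ‖v x‖ := by
        rw [norm_smul, Real.norm_eq_abs, abs_mul]
    _ ≤ |a| * (‖U x‖ * ‖g x‖) * ‖v x‖ := by gcongr; exact abs_real_inner_le_norm _ _
    _ = (|a| * ‖U x‖) • (‖g x‖ * ‖v x‖) := by rw [smul_eq_mul]; ring
    _ ≤ ‖(|a| * ‖U x‖) • (‖g x‖ * ‖v x‖)‖ := Real.le_norm_self _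

end Integrability

/-- The flux `w - 2κ⟨z, w⟩z`, whose derivative along a solution with value `z` and velocity `w` is
given by the equation. -/
noncomputable def flux (κ : ℝ) (z w : ℂ) : ℂ :=
  w - (2 * κ * ⟪z, w⟫_ℝ) • z

/-- The inverse of `flux κ z`, provided `2κ‖z‖² ≠ 1`. -/
noncomputable def velocity (κ : ℝ) (z f : ℂ) : ℂ :=
  f + (2 * κ * ⟪z, f⟫_ℝ / (1 - 2 * κ * ‖z‖ ^ 2)) • z

/-- The derivative of the flux prescribed by the equation, in terms of the value `z` and the
velocity `w` of the solution. -/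
noncomputable def source (c κ : ℝ) (z w : ℂ) : ℂ :=
  -(c • (Complex.I * w) + (1 - ‖z‖ ^ 2) • z + (2 * κ * ⟪z, w⟫_ℝ) • w)

section Algebra

theorem inner_I_mul_right (z w : ℂ) : ⟪z, Complex.I * w⟫_ℝ = -⟪Complex.I * z, w⟫_ℝ := by
  simp only [Complex.inner, map_mul, Complex.conj_I, Complex.mul_re, Complex.mul_im, Complex.neg_re,
    Complex.neg_im, Complex.I_re, Complex.I_im, Complex.conj_re, Complex.conj_im]
  ring

theorem inner_I_mul_self (z : ℂ) : ⟪Complex.I * z, z⟫_ℝ = 0 := by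
  linarith [inner_I_mul_right z z, real_inner_comm z (Complex.I * z)]

theorem inner_I_mul_I_mul (z w : ℂ) : ⟪Complex.I * z, Complex.I * w⟫_ℝ = ⟪z, w⟫_ℝ := by
  rw [inner_I_mul_right, ← mul_assoc, Complex.I_mul_I, neg_one_mul, inner_neg_left, neg_neg]

theorem inner_sq_add_inner_I_mul_sq (z w : ℂ) :
    ⟪z, w⟫_ℝ ^ 2 + ⟪Complex.I * z, w⟫_ℝ ^ 2 = ‖z‖ ^ 2 * ‖w‖ ^ 2 := by
  simp only [Complex.inner, map_mul, Complex.conj_I, Complex.mul_re, Complex.mul_im, Complex.neg_re,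
    Complex.neg_im, Complex.I_re, Complex.I_im, Complex.conj_re, Complex.conj_im, Complex.sq_norm,
    Complex.normSq_apply]
  ring

variable (c κ : ℝ) (z w f : ℂ)

theorem inner_source :
    ⟪z, source c κ z w⟫_ℝ
      = c * ⟪Complex.I * z, w⟫_ℝ - ‖z‖ ^ 2 * (1 - ‖z‖ ^ 2) - 2 * κ * ⟪z, w⟫_ℝ ^ 2 := by
  rw [source, inner_neg_right, inner_add_right, inner_add_right, real_inner_smul_right,
    real_inner_smul_right, real_inner_smul_right, inner_I_mul_right, real_inner_self_eq_norm_sq]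
  ring

theorem inner_I_mul_source :
    ⟪Complex.I * z, source c κ z w⟫_ℝ
      = -(c * ⟪z, w⟫_ℝ + 2 * κ * ⟪z, w⟫_ℝ * ⟪Complex.I * z, w⟫_ℝ) := by
  rw [source, inner_neg_right, inner_add_right, inner_add_right, real_inner_smul_right,
    real_inner_smul_right, real_inner_smul_right, inner_I_mul_I_mul, inner_I_mul_self]
  ring

theorem inner_velocity_source :
    ⟪w, source c κ z w⟫_ℝ = -((1 - ‖z‖ ^ 2) * ⟪z, w⟫_ℝ + 2 * κ * ⟪z, w⟫_ℝ * ‖w‖ ^ 2) := by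
  rw [source, inner_neg_right, inner_add_right, inner_add_right, real_inner_smul_right,
    real_inner_smul_right, real_inner_smul_right, inner_I_mul_right, inner_I_mul_self,
    real_inner_self_eq_norm_sq, real_inner_comm z w]
  ring

theorem inner_source_add_inner_flux (φ φ' : ℂ) :
    ⟪source c κ z w, φ⟫_ℝ + ⟪flux κ z w, φ'⟫_ℝ
      = -(⟪Complex.I * (c : ℂ) * w + z * ((1 - ‖z‖ ^ 2 : ℝ) : ℂ), φ⟫_ℝ - ⟪w, φ'⟫_ℝ
          + 2 * κ * ⟪z, w⟫_ℝ * (⟪w, φ⟫_ℝ + ⟪z, φ'⟫_ℝ)) := by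
  rw [mul_comm Complex.I, mul_assoc, mul_comm z, ← Complex.real_smul, ← Complex.real_smul, source,
    flux]
  simp only [inner_neg_left, inner_add_left, inner_sub_left, real_inner_smul_left]
  ring

variable {κ z}

theorem velocity_flux (hd : 1 - 2 * κ * ‖z‖ ^ 2 ≠ 0) : velocity κ z (flux κ z w) = w := by
  have hinner : ⟪z, flux κ z w⟫_ℝ = ⟪z, w⟫_ℝ * (1 - 2 * κ * ‖z‖ ^ 2) := by
    rw [flux, inner_sub_right, real_inner_smul_right, real_inner_self_eq_norm_sq]; ring
  rw [velocity, hinner, mul_div_assoc, mul_div_cancel_right₀ _ hd, flux, mul_assoc, sub_add_cancel]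

theorem inner_velocity (hd : 1 - 2 * κ * ‖z‖ ^ 2 ≠ 0) :
    ⟪z, velocity κ z f⟫_ℝ = ⟪z, f⟫_ℝ / (1 - 2 * κ * ‖z‖ ^ 2) := by
  rw [velocity, inner_add_right, real_inner_smul_right, real_inner_self_eq_norm_sq]
  field_simp
  ring

theorem flux_velocity (hd : 1 - 2 * κ * ‖z‖ ^ 2 ≠ 0) : flux κ z (velocity κ z f) = f := by
  rw [flux, inner_velocity f hd, velocity, mul_div_assoc, add_sub_cancel_right]

theorem inner_velocity_left (hd : 1 - 2 * κ * ‖z‖ ^ 2 ≠ 0) :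
    ⟪velocity κ z f, f⟫_ℝ = ‖velocity κ z f‖ ^ 2 - 2 * κ * ⟪z, velocity κ z f⟫_ℝ ^ 2 := by
  have hf := flux_velocity f hd
  generalize velocity κ z f = w at hf ⊢
  rw [← hf, flux, inner_sub_right, real_inner_smul_right, real_inner_self_eq_norm_sq,
    real_inner_comm z w]
  ring

theorem inner_I_mul_velocity_left (hd : 1 - 2 * κ * ‖z‖ ^ 2 ≠ 0) :
    ⟪Complex.I * velocity κ z f, f⟫_ℝ
      = 2 * κ * ⟪z, velocity κ z f⟫_ℝ * ⟪Complex.I * z, velocity κ z f⟫_ℝ := by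
  have hf := flux_velocity f hd
  generalize velocity κ z f = w at hf ⊢
  rw [← hf, flux, inner_sub_right, real_inner_smul_right, inner_I_mul_self,
    real_inner_comm z (Complex.I * w), inner_I_mul_right]
  ring

variable (κ z)

theorem inner_velocity_left_eq_div :
    ⟪velocity κ z f, f⟫_ℝ
      = ‖f‖ ^ 2 + 2 * κ * (⟪z, f⟫_ℝ ^ 2 / (1 - 2 * κ * ‖z‖ ^ 2)) := by
  rw [velocity, inner_add_left, real_inner_smul_left, real_inner_self_eq_norm_sq]
  ring

theorem inner_I_mul_velocity : ⟪Complex.I * z, velocity κ z f⟫_ℝ = ⟪Complex.I * z, f⟫_ℝ := by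
  rw [velocity, inner_add_right, real_inner_smul_right, inner_I_mul_self, mul_zero, add_zero]

end Algebra

section FluxForm

variable {c κ : ℝ} {U F g : ℝ → ℂ}

theorem locallyIntegrable_flux (hU : Continuous U) (hg : MemLp g 2 volume) :
    LocallyIntegrable (fun x => flux κ (U x) (g x)) volume := by
  have hgl := hg.locallyIntegrable one_le_two
  refine hgl.sub (locallyIntegrable_inner_smul hU hg.1 hU.aestronglyMeasurable ?_ (2 * κ))
  simpa only [mul_comm, smul_eq_mul] using locallyIntegrable_continuous_smul hU.norm
    (hg.norm.locallyIntegrable one_le_two)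

theorem locallyIntegrable_source (hU : Continuous U) (hg : MemLp g 2 volume) :
    LocallyIntegrable (fun x => source c κ (U x) (g x)) volume := by
  have hIg : LocallyIntegrable (fun x => c • (Complex.I * g x)) volume :=
    ((hg.locallyIntegrable one_le_two).smul Complex.I).smul c
  have hUc : Continuous fun x => (1 - ‖U x‖ ^ 2) • U x := by fun_prop
  have hgg : LocallyIntegrable (fun x => ‖g x‖ * ‖g x‖) volume := by
    simpa only [sq] using (hg.integrable_norm_pow two_ne_zero).locallyIntegrable
  exact ((hIg.add hUc.locallyIntegrable).add
    (locallyIntegrable_inner_smul hU hg.1 hg.1 hgg (2 * κ))).neg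

theorem hasWeakDeriv_flux (hU : Continuous U) (hg : MemLp g 2 volume)
    (hw : ∀ φ : ℝ → ℂ, ContDiff ℝ ∞ φ → HasCompactSupport φ →
      ∫ x, (⟪source c κ (U x) (g x), φ x⟫_ℝ + ⟪flux κ (U x) (g x), deriv φ x⟫_ℝ) = 0) :
    HasWeakDeriv (fun x => flux κ (U x) (g x)) (fun x => source c κ (U x) (g x)) := by
  refine ⟨locallyIntegrable_flux hU hg, locallyIntegrable_source hU hg, fun ψ hψ hc => ?_⟩
  have hflux := (locallyIntegrable_flux (κ := κ) hU hg).integrable_smul_left_of_hasCompactSupport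
    (hψ.continuous_deriv (by simp)) hc.deriv
  have hsource := (locallyIntegrable_source (c := c) (κ := κ) hU hg
    ).integrable_smul_left_of_hasCompactSupport hψ.continuous hc
  refine ext_inner_right ℝ fun e => ?_
  have hderiv (x : ℝ) : deriv (fun x => ψ x • e) x = deriv ψ x • e :=
    deriv_smul_const (hψ.differentiable (by simp) x) e
  have htest := hw (fun x => ψ x • e) (hψ.smul contDiff_const) hc.smul_right
  simp only [hderiv, real_inner_smul_right, ← real_inner_smul_left] at htest
  rw [integral_add (hsource.inner_const e) (hflux.inner_const e)] at htest
  rw [inner_neg_left, real_inner_comm, real_inner_comm e, ← integral_inner hflux,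
    ← integral_inner hsource]
  simp only [real_inner_comm _ e] at htest ⊢
  linarith

/-- The equation as a first-order system for an absolutely continuous representative `U` and its
flux `F`: `g` is the derivative of `U`, `F` is the flux of `(U, g)` and `F' = source c κ U g`. -/
structure IsFluxSolution (c κ : ℝ) (U F g : ℝ → ℂ) : Prop where
  memLp : MemLp g 2 volume
  memLp_one_sub_norm_sq : MemLp (fun x => 1 - ‖U x‖ ^ 2) 2 volume
  eq_primitive : ∀ x, U x = U 0 + ∫ t in (0 : ℝ)..x, g t
  flux_eq_primitive : ∀ x, F x = F 0 + ∫ t in (0 : ℝ)..x, source c κ (U t) (g t)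
  flux_eq : ∀ᵐ x, F x = flux κ (U x) (g x)

theorem exists_isFluxSolution {u : ℝ → ℂ} (hu : u ∈ EnergySpace) (hsol : IsWeakSolution c κ u) :
    ∃ U F g : ℝ → ℂ, u =ᵐ[volume] U ∧ IsFluxSolution c κ U F g := by
  obtain ⟨-, hη, g', hg', hg'2⟩ := hu
  obtain ⟨g, hg, hweak⟩ := hsol
  have hg2 : MemLp g 2 volume := hg'2.ae_eq (hg'.ae_unique hg)
  obtain ⟨C, huU⟩ := hg.exists_ae_eq_primitive
  let U : ℝ → ℂ := fun x => C + ∫ t in (0 : ℝ)..x, g t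
  have hU : Continuous U :=
    continuous_const.add (continuous_primitive_of_locallyIntegrable hg.2.1)
  have hflux : HasWeakDeriv (fun x => flux κ (U x) (g x)) (fun x => source c κ (U x) (g x)) := by
    refine hasWeakDeriv_flux hU hg2 fun φ hφ hc => ?_
    rw [← neg_eq_zero, ← integral_neg, ← hweak φ hφ hc]
    refine integral_congr_ae (huU.mono fun x hx => ?_)
    simp only [inner_source_add_inner_flux, neg_neg, hx, U]
  obtain ⟨D, hD⟩ := hflux.exists_ae_eq_primitive
  exact ⟨U, fun x => D + ∫ t in (0 : ℝ)..x, source c κ (U t) (g t), g, huU,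
    { memLp := hg2
      memLp_one_sub_norm_sq := hη.ae_eq (huU.mono fun x hx => by simp only [hx, U])
      eq_primitive := fun x => by simp [U]
      flux_eq_primitive := fun x => by simp
      flux_eq := hD.mono fun x hx => hx.symm }⟩

end FluxForm

section FirstIntegrals

theorem eq_zero_of_hasDerivAt_zero_of_memLp {E : Type*} [NormedAddCommGroup E] [NormedSpace ℝ E]
    {f : ℝ → E} {a : ℝ} {p : ENNReal} (hp₀ : p ≠ 0) (hp : p ≠ ⊤)
    (hf : ∀ x, a ≤ x → HasDerivAt f 0 x) (hfp : MemLp f p (volume.restrict (Ici a))) :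
    f a = 0 := by
  have hconst (x : ℝ) (hx : a ≤ x) : f x = f a :=
    constant_of_has_deriv_right_zero
      (fun y hy => (hf y hy.1).continuousAt.continuousWithinAt)
      (fun y hy => (hf y hy.1).hasDerivWithinAt) x ⟨hx, le_rfl⟩
  have hfa : MemLp (fun _ => f a) p (volume.restrict (Ici a)) :=
    hfp.ae_eq ((ae_restrict_iff' measurableSet_Ici).2 (.of_forall hconst))
  refine ((memLp_const_iff hp₀ hp).1 hfa).resolve_right ?_
  simp

theorem memLp_inner_of_norm_le {E : Type*} [NormedAddCommGroup E] [InnerProductSpace ℝ E]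
    {U g : ℝ → E} {p : ENNReal} {M : ℝ} (hU : Continuous U) (hM : ∀ x, ‖U x‖ ≤ M)
    (hg : MemLp g p volume) : MemLp (fun x => ⟪U x, g x⟫_ℝ) p volume :=
  hg.of_le_mul (hU.aestronglyMeasurable.inner hg.1) <| .of_forall fun x =>
    (norm_inner_le_norm _ _).trans (by gcongr; exact hM x)

theorem hasDerivAt_of_eq_primitive {E : Type*} [NormedAddCommGroup E] [NormedSpace ℝ E]
    [CompleteSpace E] {f v P : ℝ → E} {x : ℝ} (hf : LocallyIntegrable f volume)
    (hP : ∀ y, P y = P 0 + ∫ t in (0 : ℝ)..y, f t) (hv : ContinuousAt v x)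
    (hfv : v =ᶠ[𝓝 x ⊓ ae volume] f) : HasDerivAt P (v x) x := by
  refine HasDerivAt.congr_of_eventuallyEq ?_ (.of_forall hP)
  exact (intervalIntegral.integral_hasDerivAt_of_tendsto_ae_right
    (intervalIntegrable_of_locallyIntegrable hf 0 x)
    hf.aestronglyMeasurable.stronglyMeasurableAtFilter
    ((hv.tendsto.mono_left inf_le_left).congr' hfv)).const_add _

namespace IsFluxSolution

variable {c κ x : ℝ} {U F g : ℝ → ℂ}

theorem locallyIntegrable (h : IsFluxSolution c κ U F g) : LocallyIntegrable g volume :=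
  h.memLp.locallyIntegrable one_le_two

theorem continuous (h : IsFluxSolution c κ U F g) : Continuous U := by
  rw [funext h.eq_primitive]
  exact continuous_const.add (continuous_primitive_of_locallyIntegrable h.locallyIntegrable)

theorem continuous_flux (h : IsFluxSolution c κ U F g) : Continuous F := by
  rw [funext h.flux_eq_primitive]
  exact continuous_const.add
    (continuous_primitive_of_locallyIntegrable (locallyIntegrable_source h.continuous h.memLp))

theorem uniformContinuous (h : IsFluxSolution c κ U F g) : UniformContinuous U := by
  rw [funext h.eq_primitive]
  refine uniformContinuous_const.add
    ((holderWith_primitive_of_memLp one_le_two h.memLp).uniformContinuous ?_)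
  norm_num

theorem tendsto_norm_sub_one (h : IsFluxSolution c κ U F g) :
    Tendsto (fun x => ‖U x‖ - 1) (cocompact ℝ) (𝓝 0) := by
  refine tendsto_zero_of_uniformContinuous_of_integrable_norm_pow (n := 2)
    ((uniformContinuous_norm.comp h.uniformContinuous).sub uniformContinuous_const) ?_
  have hmeas : Continuous fun x => ‖‖U x‖ - 1‖ ^ 2 :=
    ((h.continuous.norm.sub continuous_const).norm).pow 2
  refine h.memLp_one_sub_norm_sq.integrable_sq.mono' hmeas.aestronglyMeasurable
    (.of_forall fun x => ?_)
  -- `1 - r² = (1 - r) (1 + r)` and `1 ≤ 1 + r`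
  have hr := norm_nonneg (U x)
  rw [Real.norm_eq_abs, abs_of_nonneg (by positivity), Real.norm_eq_abs, sq_abs]
  nlinarith [mul_nonneg hr (sq_nonneg (‖U x‖ - 1)), mul_nonneg (sq_nonneg ‖U x‖)
    (sq_nonneg (‖U x‖ - 1))]

theorem tendsto_norm_sq (h : IsFluxSolution c κ U F g) :
    Tendsto (fun x => ‖U x‖ ^ 2) (cocompact ℝ) (𝓝 1) := by
  simpa using (h.tendsto_norm_sub_one.add_const 1).pow 2

theorem exists_norm_le (h : IsFluxSolution c κ U F g) : ∃ M, ∀ x, ‖U x‖ ≤ M := by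
  let r : ZeroAtInftyContinuousMap ℝ ℝ :=
    ⟨⟨fun x => ‖U x‖ - 1, h.continuous.norm.sub continuous_const⟩, h.tendsto_norm_sub_one⟩
  obtain ⟨M, hM⟩ := r.isBounded_range.bddAbove
  exact ⟨M + 1, fun x => by linarith [show ‖U x‖ - 1 ≤ M from hM ⟨x, rfl⟩]⟩

theorem eventually_ne (h : IsFluxSolution c κ U F g) (hx : 1 - 2 * κ * ‖U x‖ ^ 2 ≠ 0) :
    ∀ᶠ y in 𝓝 x, 1 - 2 * κ * ‖U y‖ ^ 2 ≠ 0 :=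
  (continuous_const.sub (continuous_const.mul (h.continuous.norm.pow 2))).continuousAt.eventually_ne
    hx

theorem ae_velocity_eq (h : IsFluxSolution c κ U F g) :
    ∀ᵐ x, 1 - 2 * κ * ‖U x‖ ^ 2 ≠ 0 → velocity κ (U x) (F x) = g x :=
  h.flux_eq.mono fun x hx hd => by rw [hx, velocity_flux _ hd]

theorem eventually_velocity_eq (h : IsFluxSolution c κ U F g) (hx : 1 - 2 * κ * ‖U x‖ ^ 2 ≠ 0) :
    ∀ᶠ y in 𝓝 x ⊓ ae volume, velocity κ (U y) (F y) = g y := by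
  filter_upwards [(h.eventually_ne hx).filter_mono inf_le_left,
    h.ae_velocity_eq.filter_mono inf_le_right] with y hy hvel using hvel hy

theorem continuousAt_velocity (h : IsFluxSolution c κ U F g) (hx : 1 - 2 * κ * ‖U x‖ ^ 2 ≠ 0) :
    ContinuousAt (fun y => velocity κ (U y) (F y)) x := by
  have hU := h.continuous.continuousAt (x := x)
  have hF := h.continuous_flux.continuousAt (x := x)
  exact hF.add (((continuousAt_const.mul (hU.inner hF)).div
    (continuousAt_const.sub (continuousAt_const.mul (hU.norm.pow 2))) hx).smul hU)

theorem hasDerivAt (h : IsFluxSolution c κ U F g) (hx : 1 - 2 * κ * ‖U x‖ ^ 2 ≠ 0) :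
    HasDerivAt U (velocity κ (U x) (F x)) x :=
  hasDerivAt_of_eq_primitive h.locallyIntegrable h.eq_primitive (h.continuousAt_velocity hx)
    (h.eventually_velocity_eq hx)

theorem hasDerivAt_flux (h : IsFluxSolution c κ U F g) (hx : 1 - 2 * κ * ‖U x‖ ^ 2 ≠ 0) :
    HasDerivAt F (source c κ (U x) (velocity κ (U x) (F x))) x := by
  have hU := h.continuous.continuousAt (x := x)
  have hV := h.continuousAt_velocity hx
  have hcont : ContinuousAt (fun y => source c κ (U y) (velocity κ (U y) (F y))) x := by
    unfold source
    have := hU.inner (𝕜 := ℝ) hV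
    fun_prop
  exact hasDerivAt_of_eq_primitive (locallyIntegrable_source h.continuous h.memLp)
    h.flux_eq_primitive hcont
    ((h.eventually_velocity_eq hx).mono fun y hy => congrArg (source c κ (U y)) hy)

theorem hasDerivAt_norm_sq (h : IsFluxSolution c κ U F g) (hx : 1 - 2 * κ * ‖U x‖ ^ 2 ≠ 0) :
    HasDerivAt (fun y => ‖U y‖ ^ 2) (2 * ⟪U x, velocity κ (U x) (F x)⟫_ℝ) x :=
  (h.hasDerivAt hx).norm_sq

theorem hasDerivAt_inner_flux (h : IsFluxSolution c κ U F g) (hx : 1 - 2 * κ * ‖U x‖ ^ 2 ≠ 0) :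
    HasDerivAt (fun y => ⟪U y, F y⟫_ℝ)
      (‖velocity κ (U x) (F x)‖ ^ 2 - 4 * κ * ⟪U x, velocity κ (U x) (F x)⟫_ℝ ^ 2
        + c * ⟪Complex.I * U x, velocity κ (U x) (F x)⟫_ℝ - ‖U x‖ ^ 2 * (1 - ‖U x‖ ^ 2)) x := by
  refine ((h.hasDerivAt hx).inner ℝ (h.hasDerivAt_flux hx)).congr_deriv ?_
  rw [inner_source, inner_velocity_left _ hx]
  ring

theorem hasDerivAt_angular (h : IsFluxSolution c κ U F g) (hx : 1 - 2 * κ * ‖U x‖ ^ 2 ≠ 0) :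
    HasDerivAt (fun y => ⟪Complex.I * U y, F y⟫_ℝ - c / 2 * (1 - ‖U y‖ ^ 2)) 0 x := by
  refine ((((h.hasDerivAt hx).const_mul Complex.I).inner ℝ (h.hasDerivAt_flux hx)).sub
    (((h.hasDerivAt_norm_sq hx).const_sub 1).const_mul (c / 2))).congr_deriv ?_
  rw [inner_I_mul_source, inner_I_mul_velocity_left _ hx]
  ring

theorem hasDerivAt_energy (h : IsFluxSolution c κ U F g) (hx : 1 - 2 * κ * ‖U x‖ ^ 2 ≠ 0) :
    HasDerivAt (fun y => ⟪velocity κ (U y) (F y), F y⟫_ℝ - (1 - ‖U y‖ ^ 2) ^ 2 / 2) 0 x := by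
  have hρ := h.hasDerivAt_norm_sq hx
  simp only [inner_velocity_left_eq_div]
  refine (((h.hasDerivAt_flux hx).norm_sq.add
    ((((h.hasDerivAt_inner_flux hx).pow 2).div ((hρ.const_mul (2 * κ)).const_sub 1) hx).const_mul
      (2 * κ))).sub (((hρ.const_sub 1).pow 2).div_const 2)).congr_deriv ?_
  have hm : ⟪U x, F x⟫_ℝ
      = ⟪U x, velocity κ (U x) (F x)⟫_ℝ * (1 - 2 * κ * ‖U x‖ ^ 2) := by
    rw [inner_velocity _ hx, div_mul_cancel₀ _ hx]
  have hS : ⟪F x, source c κ (U x) (velocity κ (U x) (F x))⟫_ℝ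
      = ⟪velocity κ (U x) (F x), source c κ (U x) (velocity κ (U x) (F x))⟫_ℝ
        - 2 * κ * ⟪U x, velocity κ (U x) (F x)⟫_ℝ
          * ⟪U x, source c κ (U x) (velocity κ (U x) (F x))⟫_ℝ := by
    rw [← real_inner_smul_left, ← inner_sub_left, ← flux, flux_velocity _ hx]
  simp only [Pi.pow_apply]
  rw [hS, inner_velocity_source, inner_source, hm]
  generalize hD : 1 - 2 * κ * ‖U x‖ ^ 2 = D at hx ⊢
  field_simp
  rw [← hD]
  ring

theorem angular_eq (h : IsFluxSolution c κ U F g)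
    (hd : ∀ y, x ≤ y → 1 - 2 * κ * ‖U y‖ ^ 2 ≠ 0) :
    ⟪Complex.I * U x, velocity κ (U x) (F x)⟫_ℝ = c / 2 * (1 - ‖U x‖ ^ 2) := by
  obtain ⟨M, hM⟩ := h.exists_norm_le
  have hmem : MemLp (fun y => ⟪Complex.I * U y, g y⟫_ℝ - c / 2 * (1 - ‖U y‖ ^ 2)) 2 volume :=
    (memLp_inner_of_norm_le (continuous_const.mul h.continuous) (by simpa using hM) h.memLp).sub
      (h.memLp_one_sub_norm_sq.const_mul _)
  have hzero := eq_zero_of_hasDerivAt_zero_of_memLp (p := 2) (by simp) (by simp)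
    (fun y hy => h.hasDerivAt_angular (hd y hy)) <| (hmem.restrict (Ici x)).ae_eq <| by
      filter_upwards [ae_restrict_of_ae h.ae_velocity_eq, ae_restrict_mem measurableSet_Ici]
        with y hvel hy
      rw [← hvel (hd y hy), inner_I_mul_velocity]
  rw [inner_I_mul_velocity]
  exact sub_eq_zero.1 hzero

theorem energy_eq (h : IsFluxSolution c κ U F g)
    (hd : ∀ y, x ≤ y → 1 - 2 * κ * ‖U y‖ ^ 2 ≠ 0) :
    ‖velocity κ (U x) (F x)‖ ^ 2 - 2 * κ * ⟪U x, velocity κ (U x) (F x)⟫_ℝ ^ 2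
      = (1 - ‖U x‖ ^ 2) ^ 2 / 2 := by
  obtain ⟨M, hM⟩ := h.exists_norm_le
  have hint : Integrable (fun y => ‖g y‖ ^ 2 - 2 * κ * ⟪U y, g y⟫_ℝ ^ 2
      - (1 - ‖U y‖ ^ 2) ^ 2 / 2) volume :=
    ((h.memLp.integrable_norm_pow two_ne_zero).sub
      ((memLp_inner_of_norm_le h.continuous hM h.memLp).integrable_sq.const_mul _)).sub
        (h.memLp_one_sub_norm_sq.integrable_sq.div_const 2)
  have hzero := eq_zero_of_hasDerivAt_zero_of_memLp (p := 1) (by simp) (by simp)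
    (fun y hy => h.hasDerivAt_energy (hd y hy)) <|
    ((memLp_one_iff_integrable.2 hint).restrict (Ici x)).ae_eq <| by
      filter_upwards [ae_restrict_of_ae h.ae_velocity_eq, ae_restrict_mem measurableSet_Ici]
        with y hvel hy
      rw [inner_velocity_left _ (hd y hy), hvel (hd y hy)]
  rw [← inner_velocity_left _ (hd x le_rfl)]
  exact sub_eq_zero.1 hzero

theorem intensity_eq (h : IsFluxSolution c κ U F g)
    (hd : ∀ y, x ≤ y → 1 - 2 * κ * ‖U y‖ ^ 2 ≠ 0) :
    4 * ⟪U x, velocity κ (U x) (F x)⟫_ℝ ^ 2 * (1 - 2 * κ * ‖U x‖ ^ 2)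
      = (1 - ‖U x‖ ^ 2) ^ 2 * (2 * ‖U x‖ ^ 2 - c ^ 2) := by
  have hpolar := inner_sq_add_inner_I_mul_sq (U x) (velocity κ (U x) (F x))
  rw [h.angular_eq hd] at hpolar
  linear_combination 4 * hpolar + 4 * ‖U x‖ ^ 2 * h.energy_eq hd

end IsFluxSolution

end FirstIntegrals

section Rigidity

theorem eq_univ_of_eventually_atTop_of_forall_Ioi {s : Set ℝ} (hs : IsOpen s)
    (htop : ∀ᶠ x in atTop, x ∈ s) (hstep : ∀ a, Ioi a ⊆ s → a ∈ s) : s = univ := by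
  by_contra hne
  obtain ⟨b, hb⟩ := eventually_atTop.1 htop
  have hbdd : BddAbove sᶜ := ⟨b, fun x hx => le_of_not_ge fun hbx => hx (hb x hbx)⟩
  exact hs.isClosed_compl.csSup_mem (nonempty_compl.2 hne) hbdd
    (hstep _ fun y hy => not_not.1 (notMem_of_csSup_lt hy hbdd))

theorem one_sub_two_mul_norm_sq_pos {κ : ℝ} (hκ : κ ≤ 0) (z : ℂ) : 0 < 1 - 2 * κ * ‖z‖ ^ 2 := by
  nlinarith [mul_nonneg (neg_nonneg.2 hκ) (sq_nonneg ‖z‖)]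

namespace IsFluxSolution

variable {c κ x : ℝ} {U F g : ℝ → ℂ}

theorem eq_const_of_norm_sq_eq_one (h : IsFluxSolution c κ U F g) (hκ : κ ≠ 1 / 2)
    (hone : ∀ x, ‖U x‖ ^ 2 = 1) : ∃ z : ℂ, ‖z‖ = 1 ∧ ∀ x, U x = z := by
  have hd (x : ℝ) : 1 - 2 * κ * ‖U x‖ ^ 2 ≠ 0 := by
    rw [hone]
    exact fun h => hκ (by linarith)
  have hU (x : ℝ) : HasDerivAt U 0 x := by
    have hinner := (h.hasDerivAt_norm_sq (hd x)).unique
      ((hasDerivAt_const x (1 : ℝ)).congr_of_eventuallyEq (.of_forall hone))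
    have henergy := h.energy_eq (x := x) fun y _ => hd y
    rw [(mul_eq_zero.1 hinner).resolve_left two_ne_zero, hone] at henergy
    have hzero : velocity κ (U x) (F x) = 0 := by simpa using henergy
    exact hzero ▸ h.hasDerivAt (hd x)
  exact ⟨U 0, (pow_eq_one_iff_of_nonneg (norm_nonneg _) two_ne_zero).1 (hone 0), fun x =>
    is_const_of_deriv_eq_zero (fun x => (hU x).differentiableAt) (fun x => (hU x).deriv) x 0⟩

theorem norm_sq_eq_one_of_forall_neg (h : IsFluxSolution c κ U F g)
    (hneg : ∀ y, x ≤ y → (1 - 2 * κ * ‖U y‖ ^ 2) * (2 * ‖U y‖ ^ 2 - c ^ 2) < 0) :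
    ‖U x‖ ^ 2 = 1 := by
  have hintensity := h.intensity_eq (x := x) fun y hy =>
    left_ne_zero_of_mul (hneg y hy).ne
  have hsq : (2 * ⟪U x, velocity κ (U x) (F x)⟫_ℝ * (1 - 2 * κ * ‖U x‖ ^ 2)) ^ 2
      = (1 - ‖U x‖ ^ 2) ^ 2 * ((1 - 2 * κ * ‖U x‖ ^ 2) * (2 * ‖U x‖ ^ 2 - c ^ 2)) := by
    linear_combination (1 - 2 * κ * ‖U x‖ ^ 2) * hintensity
  by_contra hne
  have hpos : 0 < (1 - ‖U x‖ ^ 2) ^ 2 := by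
    have := sub_ne_zero.2 (Ne.symm hne)
    positivity
  exact (mul_neg_of_pos_of_neg hpos (hneg x le_rfl)).not_ge (hsq ▸ sq_nonneg _)

theorem norm_sq_eq_one_of_neg (h : IsFluxSolution c κ U F g)
    (hneg : (1 - 2 * κ) * (2 - c ^ 2) < 0) (x : ℝ) : ‖U x‖ ^ 2 = 1 := by
  let N : ℝ → ℝ := fun r => (1 - 2 * κ * r) * (2 * r - c ^ 2)
  have hN : Continuous N := by fun_prop
  have hN1 : N 1 < 0 := by simpa only [N, mul_one] using hneg
  have hU : Continuous fun y => ‖U y‖ ^ 2 := h.continuous.norm.pow 2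
  have hsuniv : {y | N (‖U y‖ ^ 2) < 0} = univ := by
    refine eq_univ_of_eventually_atTop_of_forall_Ioi
      (isOpen_lt (hN.comp hU) continuous_const) ?_ fun a ha => ?_
    · exact ((hN.tendsto 1).comp
        (h.tendsto_norm_sq.mono_left atTop_le_cocompact)).eventually_lt_const hN1
    · have hone : EqOn (fun y => ‖U y‖ ^ 2) (fun _ => 1) (Ioi a) := fun y hy =>
        h.norm_sq_eq_one_of_forall_neg fun z hz => ha (lt_of_lt_of_le hy hz)
      have hclosure := hone.closure hU continuous_const
      rw [closure_Ioi] at hclosure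
      simpa only [mem_ofPred_eq, show ‖U a‖ ^ 2 = 1 from hclosure self_mem_Ici] using hN1
  exact h.norm_sq_eq_one_of_forall_neg fun y _ => hsuniv.ge (mem_univ y)

theorem contDiff (h : IsFluxSolution c κ U F g) (hκ : κ ≤ 0) : ContDiff ℝ ∞ U := by
  have hd (x : ℝ) := (one_sub_two_mul_norm_sq_pos hκ (U x)).ne'
  have hU (x : ℝ) := h.hasDerivAt (hd x)
  have hF (x : ℝ) := h.hasDerivAt_flux (hd x)
  have hbootstrap (n : ℕ) : ContDiff ℝ n U ∧ ContDiff ℝ n F := by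
    induction n with
    | zero => exact ⟨contDiff_zero.2 h.continuous, contDiff_zero.2 h.continuous_flux⟩
    | succ n ih =>
      obtain ⟨hUn, hFn⟩ := ih
      have hVn : ContDiff ℝ n fun x => velocity κ (U x) (F x) :=
        hFn.add (((contDiff_const.mul (hUn.inner ℝ hFn)).div
          (contDiff_const.sub (contDiff_const.mul (hUn.norm_sq ℝ))) hd).smul hUn)
      have hSn : ContDiff ℝ n fun x => source c κ (U x) (velocity κ (U x) (F x)) :=
        ((((contDiff_const.mul hVn).const_smul c).add
          ((contDiff_const.sub (hUn.norm_sq ℝ)).smul hUn)).add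
            ((contDiff_const.mul (hUn.inner ℝ hVn)).smul hVn)).neg
      push_cast
      rw [contDiff_succ_iff_deriv, contDiff_succ_iff_deriv, funext fun x => (hU x).deriv,
        funext fun x => (hF x).deriv]
      exact ⟨⟨fun x => (hU x).differentiableAt, by simp, hVn⟩,
        fun x => (hF x).differentiableAt, by simp, hSn⟩
  exact contDiff_infty.2 fun n => (hbootstrap n).1

theorem exists_forall_sq_le (h : IsFluxSolution c κ U F g) (hx : ‖U x‖ ^ 2 ≠ 1) :
    ∃ x₀, ‖U x₀‖ ^ 2 ≠ 1 ∧ ∀ y, (1 - ‖U y‖ ^ 2) ^ 2 ≤ (1 - ‖U x₀‖ ^ 2) ^ 2 := by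
  have hpos : 0 < (1 - ‖U x‖ ^ 2) ^ 2 := by
    have := sub_ne_zero.2 hx.symm
    positivity
  have hlim : Tendsto (fun y => (1 - ‖U y‖ ^ 2) ^ 2) (cocompact ℝ) (𝓝 0) := by
    simpa using (h.tendsto_norm_sq.const_sub 1).pow 2
  have hU := h.continuous
  obtain ⟨x₀, hx₀⟩ := Continuous.exists_forall_ge' (f := fun y => (1 - ‖U y‖ ^ 2) ^ 2)
    (by fun_prop) x (hlim.eventually_le_const hpos)
  refine ⟨x₀, fun hone => (hpos.trans_le (hx₀ x)).ne' ?_, hx₀⟩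
  rw [hone, sub_self, zero_pow two_ne_zero]

theorem two_mul_norm_sq_eq_of_forall_sq_le (h : IsFluxSolution c κ U F g) (hκ : κ ≤ 0)
    (hx : ‖U x‖ ^ 2 ≠ 1) (hmax : ∀ y, (1 - ‖U y‖ ^ 2) ^ 2 ≤ (1 - ‖U x‖ ^ 2) ^ 2) :
    2 * ‖U x‖ ^ 2 = c ^ 2 ∧ ⟪U x, F x⟫_ℝ = 0 := by
  have hd (y : ℝ) := (one_sub_two_mul_norm_sq_pos hκ (U y)).ne'
  have hη : 1 - ‖U x‖ ^ 2 ≠ 0 := sub_ne_zero.2 hx.symm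
  have hlocal : IsLocalMax ((fun y => 1 - ‖U y‖ ^ 2) ^ 2) x := .of_forall hmax
  have hinner : ⟪U x, velocity κ (U x) (F x)⟫_ℝ = 0 := by
    simpa [hη] using hlocal.hasDerivAt_eq_zero (((h.hasDerivAt_norm_sq (hd x)).const_sub 1).pow 2)
  have hintensity := h.intensity_eq (x := x) fun y _ => hd y
  rw [hinner, zero_pow two_ne_zero, mul_zero, zero_mul, eq_comm, mul_eq_zero] at hintensity
  refine ⟨sub_eq_zero.1 (hintensity.resolve_left (pow_ne_zero 2 hη)), ?_⟩
  exact (div_eq_zero_iff.1 (inner_velocity (F x) (hd x) ▸ hinner)).resolve_right (hd x)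

end IsFluxSolution

end Rigidity

section Artanh

theorem hasDerivAt_artanh {x : ℝ} (hx : x ∈ Ioo (-1) 1) :
    HasDerivAt Real.artanh (1 / (1 - x ^ 2)) x := by
  have hadd : 1 + x ≠ 0 := by linarith [hx.1]
  have hsub : 1 - x ≠ 0 := by linarith [hx.2]
  have hlog : HasDerivAt (fun y : ℝ => 1 / 2 * (Real.log (1 + y) - Real.log (1 - y)))
      (1 / 2 * (1 / (1 + x) - (-1) / (1 - x))) x :=
    ((((hasDerivAt_id x).const_add 1).log hadd).sub
      (((hasDerivAt_id x).const_sub 1).log hsub)).const_mul _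
  refine (hlog.congr_of_eventuallyEq ?_).congr_deriv ?_
  · filter_upwards [Ioo_mem_nhds hx.1 hx.2] with y hy
    rw [Real.artanh_eq_half_log ⟨hy.1.le, hy.2.le⟩, Real.log_div (by linarith [hy.1])
      (by linarith [hy.2])]
  · rw [show 1 - x ^ 2 = (1 + x) * (1 - x) by ring]
    field_simp
    ring

theorem tendsto_artanh_atTop : Tendsto Real.artanh (𝓝[<] 1) atTop := by
  refine tendsto_atTop.2 fun M => ?_
  filter_upwards [Ioo_mem_nhdsLT (Real.tanh_lt_one M)] with x hx
  rw [← Real.artanh_tanh M]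
  exact Real.strictMonoOn_artanh.monotoneOn ⟨Real.neg_one_lt_tanh M, Real.tanh_lt_one M⟩
    ⟨(Real.neg_one_lt_tanh M).trans hx.1, hx.2⟩ hx.1.le

variable {m : ℝ}

theorem mul_sqrt_mem_Ioo {r : ℝ} (hr : 0 ≤ r) (hlt : m ^ 2 * r < 1) : m * √r ∈ Ioo (-1) 1 := by
  refine abs_lt.1 ((sq_lt_one_iff_abs_lt_one _).1 ?_)
  rwa [mul_pow, Real.sq_sqrt hr]

variable {r : ℝ → ℝ} {y : ℝ}

theorem continuousAt_artanh_mul_sqrt (hr : ContinuousAt r y) (hr₀ : 0 ≤ r y)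
    (hlt : m ^ 2 * r y < 1) : ContinuousAt (fun t => Real.artanh (m * √(r t))) y :=
  (hasDerivAt_artanh (mul_sqrt_mem_Ioo hr₀ hlt)).continuousAt.comp
    (f := fun t => m * √(r t)) (continuousAt_const.mul hr.sqrt)

theorem hasDerivAt_artanh_mul_sqrt {r' : ℝ} (hr : HasDerivAt r r' y) (hr₀ : 0 < r y)
    (hlt : m ^ 2 * r y < 1) :
    HasDerivAt (fun t => Real.artanh (m * √(r t)))
      (m * r' / (2 * √(r y) * (1 - m ^ 2 * r y))) y := by
  refine ((hasDerivAt_artanh (mul_sqrt_mem_Ioo hr₀.le hlt)).comp y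
    ((hr.sqrt hr₀.ne').const_mul m)).congr_deriv ?_
  rw [mul_pow, Real.sq_sqrt hr₀.le, mul_div_assoc', one_div_mul_eq_div, div_div]

end Artanh

/-- The quotient `(2 - c² - 2y) / (1 - 2κ + 2κy)` under the square roots in `G`; the first-order
equation of the intensity profile is `η' = -η √(ratio c κ η)`. -/
noncomputable def ratio (c κ y : ℝ) : ℝ := (2 - c ^ 2 - 2 * y) / (1 - 2 * κ + 2 * κ * y)

section ImplicitProfile

variable {c κ y : ℝ}

theorem ratio_den_pos (hκ : κ ≤ 0) (hy : y ≤ 1) : 0 < 1 - 2 * κ + 2 * κ * y := by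
  nlinarith [mul_nonneg (neg_nonneg.2 hκ) (sub_nonneg.2 hy)]

theorem le_one_of_le (hy : y ≤ 1 - c ^ 2 / 2) : y ≤ 1 := by
  linarith [sq_nonneg c]

theorem one_sub_kappa_mul_sq_pos (hκ : κ ≤ 0) : 0 < 1 - κ * c ^ 2 := by
  nlinarith [mul_nonneg (neg_nonneg.2 hκ) (sq_nonneg c)]

theorem ratio_nonneg (hκ : κ ≤ 0) (hy : y ≤ 1 - c ^ 2 / 2) : 0 ≤ ratio c κ y :=
  div_nonneg (by linarith) (ratio_den_pos hκ (le_one_of_le hy)).le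

theorem ratio_pos (hκ : κ ≤ 0) (hy : y < 1 - c ^ 2 / 2) : 0 < ratio c κ y :=
  div_pos (by linarith) (ratio_den_pos hκ (le_one_of_le hy.le))

theorem hasDerivAt_ratio (hκ : κ ≤ 0) (hy : y ≤ 1) :
    HasDerivAt (ratio c κ) (-2 * (1 - κ * c ^ 2) / (1 - 2 * κ + 2 * κ * y) ^ 2) y := by
  refine ((((hasDerivAt_id y).const_mul 2).const_sub (2 - c ^ 2)).div
    (((hasDerivAt_id y).const_mul (2 * κ)).const_add (1 - 2 * κ))
    (ratio_den_pos hκ hy).ne').congr_deriv ?_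
  simp only [id]
  ring

theorem one_sub_sq_sqrt_mul_ratio (hκ : κ ≤ 0) (hy : y ≤ 1) :
    1 - √(-κ) ^ 2 * ratio c κ y = (1 - κ * c ^ 2) / (1 - 2 * κ + 2 * κ * y) := by
  have hden := (ratio_den_pos hκ hy).ne'
  rw [Real.sq_sqrt (neg_nonneg.2 hκ), ratio, mul_div_assoc', eq_div_iff hden, sub_mul,
    div_mul_cancel₀ _ hden]
  ring

theorem one_sub_sq_sqrt_div_mul_ratio (hκ : κ ≤ 0) (hc : c ^ 2 < 2) (hy : y ≤ 1) :
    1 - √((1 - 2 * κ) / (2 - c ^ 2)) ^ 2 * ratio c κ y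
      = 2 * y * (1 - κ * c ^ 2) / ((2 - c ^ 2) * (1 - 2 * κ + 2 * κ * y)) := by
  have hden := (ratio_den_pos hκ hy).ne'
  have hc' : 2 - c ^ 2 ≠ 0 := by linarith
  rw [Real.sq_sqrt (div_nonneg (by linarith) (by linarith)), ratio]
  field_simp
  ring

theorem sq_sqrt_mul_ratio_lt_one (hκ : κ ≤ 0) (hy : y ≤ 1) : √(-κ) ^ 2 * ratio c κ y < 1 := by
  rw [← sub_pos, one_sub_sq_sqrt_mul_ratio hκ hy]
  exact div_pos (one_sub_kappa_mul_sq_pos hκ) (ratio_den_pos hκ hy)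

theorem sq_sqrt_div_mul_ratio_lt_one (hκ : κ ≤ 0) (hc : c ^ 2 < 2) (hy : y ∈ Ioc 0 1) :
    √((1 - 2 * κ) / (2 - c ^ 2)) ^ 2 * ratio c κ y < 1 := by
  rw [← sub_pos, one_sub_sq_sqrt_div_mul_ratio hκ hc hy.2]
  exact div_pos (mul_pos (mul_pos two_pos hy.1) (one_sub_kappa_mul_sq_pos hκ))
    (mul_pos (by linarith) (ratio_den_pos hκ hy.2))

theorem G_eq_artanh (hκ : κ ≤ 0) (hc : c ^ 2 < 2) :
    G c κ = fun y => -2 * √(-κ) * Real.artanh (√(-κ) * √(ratio c κ y))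
      + 2 * √((1 - 2 * κ) / (2 - c ^ 2))
        * Real.artanh (√((1 - 2 * κ) / (2 - c ^ 2)) * √(ratio c κ y)) := by
  ext y
  rw [G, ← Real.sqrt_mul (div_nonneg (by linarith) (by linarith)), ratio, div_mul_div_comm]

theorem continuousAt_G (hκ : κ ≤ 0) (hc : c ^ 2 < 2) (hy : y ∈ Ic c) :
    ContinuousAt (G c κ) y := by
  have hy1 := le_one_of_le hy.2
  have hr := (hasDerivAt_ratio (c := c) hκ hy1).continuousAt
  have hr₀ := ratio_nonneg hκ hy.2
  rw [G_eq_artanh hκ hc]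
  exact (continuousAt_const.mul (continuousAt_artanh_mul_sqrt hr hr₀
    (sq_sqrt_mul_ratio_lt_one hκ hy1))).add (continuousAt_const.mul
      (continuousAt_artanh_mul_sqrt hr hr₀ (sq_sqrt_div_mul_ratio_lt_one hκ hc ⟨hy.1, hy1⟩)))

theorem hasDerivAt_G (hκ : κ ≤ 0) (hc : c ^ 2 < 2) (hy : y ∈ Ioo 0 (1 - c ^ 2 / 2)) :
    HasDerivAt (G c κ) (-1 / (y * √(ratio c κ y))) y := by
  have hy0 := hy.1.ne'
  have hy1 := le_one_of_le hy.2.le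
  have hr := hasDerivAt_ratio (c := c) hκ hy1
  have hr₀ := ratio_pos hκ hy.2
  rw [G_eq_artanh hκ hc]
  refine (((hasDerivAt_artanh_mul_sqrt hr hr₀ (sq_sqrt_mul_ratio_lt_one hκ hy1)).const_mul _).add
    ((hasDerivAt_artanh_mul_sqrt hr hr₀ (sq_sqrt_div_mul_ratio_lt_one hκ hc ⟨hy.1, hy1⟩)).const_mul
      _)).congr_deriv ?_
  have ha := Real.sq_sqrt (neg_nonneg.2 hκ)
  have hb : √((1 - 2 * κ) / (2 - c ^ 2)) ^ 2 = (1 - 2 * κ) / (2 - c ^ 2) :=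
    Real.sq_sqrt (div_nonneg (by linarith) (by linarith))
  rw [one_sub_sq_sqrt_mul_ratio hκ hy1, one_sub_sq_sqrt_div_mul_ratio hκ hc hy1]
  have hs := (Real.sqrt_pos.2 hr₀).ne'
  have hden := (ratio_den_pos hκ hy1).ne'
  have hQ := (one_sub_kappa_mul_sq_pos (c := c) hκ).ne'
  have hc' : 2 - c ^ 2 ≠ 0 := by linarith
  generalize √((1 - 2 * κ) / (2 - c ^ 2)) = b at hb ⊢
  rw [eq_div_iff hc'] at hb
  generalize √(ratio c κ y) = s at hs ⊢
  generalize hD : 1 - 2 * κ + 2 * κ * y = D at hden ⊢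
  field_simp
  linear_combination 2 * y * ha - hb - hD

theorem strictAntiOn_G (hκ : κ ≤ 0) (hc : c ^ 2 < 2) : StrictAntiOn (G c κ) (Ic c) := by
  refine strictAntiOn_of_deriv_neg (convex_Ioc _ _)
    (fun y hy => (continuousAt_G hκ hc hy).continuousWithinAt) fun y hy => ?_
  rw [interior_Ioc] at hy
  rw [(hasDerivAt_G hκ hc hy).deriv]
  exact div_neg_of_neg_of_pos (by norm_num)
    (mul_pos hy.1 (Real.sqrt_pos.2 (ratio_pos hκ hy.2)))

theorem G_right_end (hκ : κ ≤ 0) (hc : c ^ 2 < 2) : G c κ (1 - c ^ 2 / 2) = 0 := by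
  have hratio : ratio c κ (1 - c ^ 2 / 2) = 0 := by rw [ratio]; ring
  simp [G_eq_artanh hκ hc, hratio]

theorem tendsto_G_atTop (hκ : κ ≤ 0) (hc : c ^ 2 < 2) : Tendsto (G c κ) (𝓝[>] 0) atTop := by
  have hr := (hasDerivAt_ratio (c := c) hκ zero_le_one).continuousAt
  have hr₀ : 0 ≤ ratio c κ 0 := ratio_nonneg hκ (by linarith)
  have hb : 0 < √((1 - 2 * κ) / (2 - c ^ 2)) :=
    Real.sqrt_pos.2 (div_pos (by linarith) (by linarith))
  have hone : √((1 - 2 * κ) / (2 - c ^ 2)) * √(ratio c κ 0) = 1 := by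
    have hsq := one_sub_sq_sqrt_div_mul_ratio (y := 0) hκ hc zero_le_one
    rw [mul_zero, zero_mul, zero_div, sub_eq_zero, ← Real.sq_sqrt hr₀, ← mul_pow, eq_comm,
      pow_eq_one_iff_of_nonneg (by positivity) two_ne_zero] at hsq
    exact hsq
  have hfirst := (continuousAt_artanh_mul_sqrt hr hr₀
    (sq_sqrt_mul_ratio_lt_one hκ zero_le_one)).mono_left (nhdsWithin_le_nhds (s := Ioi 0))
  have harg : Tendsto (fun y => √((1 - 2 * κ) / (2 - c ^ 2)) * √(ratio c κ y)) (𝓝[>] 0)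
      (𝓝[<] 1) := by
    have hlim := (hr.sqrt.tendsto.const_mul √((1 - 2 * κ) / (2 - c ^ 2))).mono_left
      (nhdsWithin_le_nhds (s := Ioi 0))
    rw [hone] at hlim
    refine tendsto_nhdsWithin_iff.2 ⟨hlim, ?_⟩
    filter_upwards [Ioc_mem_nhdsGT (show (0 : ℝ) < 1 - c ^ 2 / 2 by linarith)] with y hy
    exact (mul_sqrt_mem_Ioo (ratio_nonneg hκ hy.2)
      (sq_sqrt_div_mul_ratio_lt_one hκ hc ⟨hy.1, le_one_of_le hy.2⟩)).2
  rw [G_eq_artanh hκ hc]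
  exact (hfirst.const_mul _).add_atTop
    ((tendsto_artanh_atTop.comp harg).const_mul_atTop (by positivity))

theorem bijOn_G (hκ : κ ≤ 0) (hc : c ^ 2 < 2) : BijOn (G c κ) (Ic c) (Ici 0) := by
  have hend : 0 < 1 - c ^ 2 / 2 := by linarith
  refine ⟨fun y hy => ?_, (strictAntiOn_G hκ hc).injOn, fun x hx => ?_⟩
  · rw [mem_Ici, ← G_right_end hκ hc]
    exact (strictAntiOn_G hκ hc).antitoneOn hy ⟨hend, le_rfl⟩ hy.2
  · obtain ⟨δ, hδG, hδ⟩ := (((tendsto_G_atTop hκ hc).eventually_ge_atTop x).and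
      (Ioc_mem_nhdsGT hend)).exists
    have hsub : Icc δ (1 - c ^ 2 / 2) ⊆ Ic c := fun y hy => ⟨hδ.1.trans_le hy.1, hy.2⟩
    have hivt := intermediate_value_Icc' hδ.2
      fun y hy => (continuousAt_G hκ hc (hsub hy)).continuousWithinAt
    exact image_mono hsub (hivt ⟨by rwa [G_right_end hκ hc], hδG⟩)

theorem eta_mem_Ic (hκ : κ ≤ 0) (hc : c ^ 2 < 2) (x : ℝ) : eta c κ x ∈ Ic c :=
  (bijOn_G hκ hc).surjOn.mapsTo_invFunOn (abs_nonneg x)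

theorem G_eta (hκ : κ ≤ 0) (hc : c ^ 2 < 2) (x : ℝ) : G c κ (eta c κ x) = |x| :=
  (bijOn_G hκ hc).surjOn.rightInvOn_invFunOn (abs_nonneg x)

theorem eta_eq_right_end_iff (hκ : κ ≤ 0) (hc : c ^ 2 < 2) {x : ℝ} :
    eta c κ x = 1 - c ^ 2 / 2 ↔ x = 0 := by
  rw [← (bijOn_G hκ hc).injOn.eq_iff (eta_mem_Ic hκ hc x) ⟨by linarith, le_rfl⟩, G_eta hκ hc,
    G_right_end hκ hc, abs_eq_zero]

/-- `e` describes the intensity deficit `1 - |u|²` of a soliton on one side of its centre: it starts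
from the maximal value `1 - c² / 2` and decreases according to `e' = -e √(ratio c κ e)`. -/
structure HalfProfile (c κ : ℝ) (e : ℝ → ℝ) : Prop where
  continuous : Continuous e
  zero : e 0 = 1 - c ^ 2 / 2
  mem_Ioo : ∀ x, 0 < x → e x ∈ Ioo 0 (1 - c ^ 2 / 2)
  hasDerivAt : ∀ x, 0 < x → HasDerivAt e (-(e x * √(ratio c κ (e x)))) x

namespace HalfProfile

variable {e : ℝ → ℝ} {x : ℝ}

theorem mem_Ic (h : HalfProfile c κ e) (hc : c ^ 2 < 2) (hx : 0 ≤ x) : e x ∈ Ic c := by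
  rcases hx.eq_or_lt with rfl | hx
  · exact h.zero ▸ ⟨by linarith, le_rfl⟩
  · exact Ioo_subset_Ioc_self (h.mem_Ioo x hx)

theorem G_eq (h : HalfProfile c κ e) (hκ : κ ≤ 0) (hc : c ^ 2 < 2) (hx : 0 ≤ x) :
    G c κ (e x) = x := by
  rcases hx.eq_or_lt with rfl | hx
  · rw [h.zero, G_right_end hκ hc]
  have hcont : ContinuousOn (fun t => G c κ (e t)) (Icc 0 x) := fun t ht =>
    ((continuousAt_G hκ hc (h.mem_Ic hc ht.1)).comp h.continuous.continuousAt).continuousWithinAt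
  have hderiv (t : ℝ) (ht : t ∈ Ioo 0 x) : HasDerivAt (fun t => G c κ (e t)) 1 t := by
    have het := h.mem_Ioo t ht.1
    refine ((hasDerivAt_G hκ hc het).comp t (h.hasDerivAt t ht.1)).congr_deriv ?_
    have hpos : 0 < e t * √(ratio c κ (e t)) :=
      mul_pos het.1 (Real.sqrt_pos.2 (ratio_pos hκ het.2))
    rw [div_mul_eq_mul_div, neg_one_mul, neg_neg, div_self hpos.ne']
  obtain ⟨t, -, hslope⟩ := exists_hasDerivAt_eq_slope _ _ hx hcont hderiv
  rwa [h.zero, G_right_end hκ hc, sub_zero, sub_zero, eq_comm, div_eq_one_iff_eq hx.ne'] at hslope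

theorem eta_eq (h : HalfProfile c κ e) (hκ : κ ≤ 0) (hc : c ^ 2 < 2) (x : ℝ) :
    eta c κ x = e |x| :=
  (bijOn_G hκ hc).injOn (eta_mem_Ic hκ hc x) (h.mem_Ic hc (abs_nonneg x)) <| by
    rw [G_eta hκ hc, h.G_eq hκ hc (abs_nonneg x)]

end HalfProfile

end ImplicitProfile

section ScalarODE

variable {f f' : ℝ → ℝ} {x₀ x : ℝ}

theorem pos_of_deriv_pos_at_zeros (hf : ∀ y, x₀ ≤ y → HasDerivAt f (f' y) y)
    (hpos : ∀ y, x₀ ≤ y → f y = 0 → 0 < f' y) (hx₀ : f x₀ = 0) (hx : x₀ < x) : 0 < f x := by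
  have hnonneg (y : ℝ) (hy : x₀ ≤ y) : 0 ≤ f y := by
    have hbarrier := image_le_of_deriv_right_lt_deriv_boundary (f := fun t => -f t)
      (f' := fun t => -f' t) (a := x₀) (b := y) (B := fun _ => 0) (B' := fun _ => 0)
      (fun t ht => (hf t ht.1).neg.continuousAt.continuousWithinAt)
      (fun t ht => (hf t ht.1).neg.hasDerivWithinAt) (by simp [hx₀]) (fun t => hasDerivAt_const _ _)
      (fun t ht hzero => neg_lt_zero.2 (hpos t ht.1 (neg_eq_zero.1 hzero))) (right_mem_Icc.2 hy)
    exact neg_nonpos.1 hbarrier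
  refine (hnonneg x hx.le).lt_of_ne fun hzero => ?_
  have hmin : IsLocalMin f x := by
    filter_upwards [Ioi_mem_nhds hx] with y hy
    exact hzero ▸ hnonneg y (le_of_lt hy)
  exact (hpos x hx.le hzero.symm).ne' (hmin.hasDerivAt_eq_zero (hf x hx.le))

theorem eq_zero_of_abs_deriv_le_mul_abs {K : ℝ} (hf : ∀ y, HasDerivAt f (f' y) y)
    (hbound : ∀ y, |f' y| ≤ K * |f y|) (hx₀ : f x₀ = 0) (x : ℝ) : f x = 0 := by
  -- Grönwall along the segment from `x₀` to `x`, so that no orientation has to be distinguished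
  have hpath (t : ℝ) : HasDerivAt (fun t => f (x₀ + t * (x - x₀)))
      ((x - x₀) * f' (x₀ + t * (x - x₀))) t :=
    ((hf _).scomp t (((hasDerivAt_id t).mul_const (x - x₀)).const_add x₀)).congr_deriv (by simp)
  have hgronwall := eq_zero_of_abs_deriv_le_mul_abs_self_of_eq_zero_right
    (f := fun t => f (x₀ + t * (x - x₀))) (a := 0) (b := 1) (K := |x - x₀| * K)
    (fun t _ => (hpath t).continuousAt.continuousWithinAt)
    (fun t _ => (hpath t).hasDerivWithinAt) (by simpa using hx₀)
    (fun t _ => by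
      rw [Real.norm_eq_abs, Real.norm_eq_abs, abs_mul, mul_assoc]
      gcongr
      exact hbound _) 1 (right_mem_Icc.2 zero_le_one)
  simpa using hgronwall

end ScalarODE

section Intensity

namespace IsFluxSolution

variable {c κ x x₀ s : ℝ} {U F g : ℝ → ℂ}

theorem sq_two_mul_inner_velocity (h : IsFluxSolution c κ U F g) (hκ : κ ≤ 0) (x : ℝ) :
    (2 * ⟪U x, velocity κ (U x) (F x)⟫_ℝ) ^ 2
      = (1 - ‖U x‖ ^ 2) ^ 2 * ratio c κ (1 - ‖U x‖ ^ 2) := by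
  have hd (y : ℝ) := (one_sub_two_mul_norm_sq_pos hκ (U y)).ne'
  have hden : 1 - 2 * κ + 2 * κ * (1 - ‖U x‖ ^ 2) = 1 - 2 * κ * ‖U x‖ ^ 2 := by ring
  rw [ratio, hden, mul_div_assoc', eq_div_iff (hd x)]
  linear_combination h.intensity_eq (x := x) fun y _ => hd y

theorem abs_two_mul_inner_velocity_le (h : IsFluxSolution c κ U F g) (hκ : κ ≤ 0) {M : ℝ}
    (hM : ‖U x‖ ≤ M) :
    |2 * ⟪U x, velocity κ (U x) (F x)⟫_ℝ| ≤ 2 * M * |1 - ‖U x‖ ^ 2| := by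
  have hM₀ : 0 ≤ M := (norm_nonneg _).trans hM
  have hratio : ratio c κ (1 - ‖U x‖ ^ 2) ≤ (2 * M) ^ 2 := by
    have hd := one_sub_two_mul_norm_sq_pos hκ (U x)
    rw [ratio, show 1 - 2 * κ + 2 * κ * (1 - ‖U x‖ ^ 2) = 1 - 2 * κ * ‖U x‖ ^ 2 by ring,
      div_le_iff₀ hd]
    nlinarith [pow_le_pow_left₀ (norm_nonneg (U x)) hM 2, sq_nonneg c, sq_nonneg M,
      mul_nonneg (neg_nonneg.2 hκ) (mul_nonneg (sq_nonneg ‖U x‖) (sq_nonneg M))]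
  refine abs_le_of_sq_le_sq' ?_ (by positivity) |> abs_le.2
  rw [h.sq_two_mul_inner_velocity hκ, mul_pow, sq_abs, mul_comm]
  gcongr

theorem norm_sq_lt_one (h : IsFluxSolution c κ U F g) (hκ : κ ≤ 0) (hx₀ : ‖U x₀‖ ^ 2 < 1)
    (x : ℝ) : ‖U x‖ ^ 2 < 1 := by
  obtain ⟨M, hM⟩ := h.exists_norm_le
  by_contra hx
  have hcont : Continuous fun y => 1 - ‖U y‖ ^ 2 := continuous_const.sub (h.continuous.norm.pow 2)
  obtain ⟨y, hy⟩ := mem_range_of_exists_le_of_exists_ge hcont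
    ⟨x, sub_nonpos.2 (not_lt.1 hx)⟩ ⟨x₀, (sub_pos.2 hx₀).le⟩
  have hzero := eq_zero_of_abs_deriv_le_mul_abs (K := 2 * M)
    (fun y => (h.hasDerivAt_norm_sq (one_sub_two_mul_norm_sq_pos hκ (U y)).ne').const_sub 1)
    (fun y => by rw [abs_neg]; exact h.abs_two_mul_inner_velocity_le hκ (hM y)) hy x₀
  linarith

theorem deriv_inner_flux_pos (h : IsFluxSolution c κ U F g) (hκ : κ ≤ 0)
    (hlt : ‖U x‖ ^ 2 < 1) (hzero : ⟪U x, F x⟫_ℝ = 0) :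
    0 < ‖velocity κ (U x) (F x)‖ ^ 2 - 4 * κ * ⟪U x, velocity κ (U x) (F x)⟫_ℝ ^ 2
        + c * ⟪Complex.I * U x, velocity κ (U x) (F x)⟫_ℝ - ‖U x‖ ^ 2 * (1 - ‖U x‖ ^ 2) := by
  have hd (y : ℝ) := (one_sub_two_mul_norm_sq_pos hκ (U y)).ne'
  have hη := sub_pos.2 hlt
  have hinner : ⟪U x, velocity κ (U x) (F x)⟫_ℝ = 0 := by
    rw [inner_velocity _ (hd x), hzero, zero_div]
  have henergy := h.energy_eq (x := x) fun y _ => hd y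
  have hintensity := h.intensity_eq (x := x) fun y _ => hd y
  rw [hinner] at henergy hintensity
  have hρ : 2 * ‖U x‖ ^ 2 - c ^ 2 = 0 :=
    (mul_eq_zero.1 (hintensity.symm.trans (by ring))).resolve_left (pow_pos hη 2).ne'
  rw [h.angular_eq fun y _ => hd y, hinner]
  have hη₂ := pow_pos hη 2
  linear_combination hη₂ / 2 - henergy + (1 - ‖U x‖ ^ 2) / 2 * hρ

theorem mul_inner_velocity_pos (h : IsFluxSolution c κ U F g) (hκ : κ ≤ 0)
    (hlt : ∀ y, ‖U y‖ ^ 2 < 1) (hx₀ : ⟪U x₀, F x₀⟫_ℝ = 0) (hs : s ^ 2 = 1) {t : ℝ} (ht : 0 < t) :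
    0 < s * ⟪U (x₀ + s * t), velocity κ (U (x₀ + s * t)) (F (x₀ + s * t))⟫_ℝ := by
  have hs₀ : s ≠ 0 := fun hs₀ => by norm_num [hs₀] at hs
  have hd (y : ℝ) := one_sub_two_mul_norm_sq_pos hκ (U y)
  have hpath (t : ℝ) := ((h.hasDerivAt_inner_flux (hd (x₀ + s * t)).ne').comp t
    (((hasDerivAt_id t).const_mul s).const_add x₀)).const_mul s
  have hpos := pos_of_deriv_pos_at_zeros (x₀ := 0) (fun t _ => hpath t) (fun t _ hzero => by
    rw [mul_one, mul_left_comm, ← sq, hs, mul_one]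
    exact h.deriv_inner_flux_pos hκ (hlt _) ((mul_eq_zero.1 hzero).resolve_left hs₀))
    (by simp only [Function.comp_apply, id, mul_zero, add_zero, hx₀]) ht
  rw [inner_velocity _ (hd _).ne', mul_div_assoc']
  exact div_pos hpos (hd _)

theorem halfProfile (h : IsFluxSolution c κ U F g) (hκ : κ ≤ 0) (hlt : ∀ y, ‖U y‖ ^ 2 < 1)
    (hx₀ : ⟪U x₀, F x₀⟫_ℝ = 0) (hcenter : 2 * ‖U x₀‖ ^ 2 = c ^ 2) (hs : s ^ 2 = 1) :
    HalfProfile c κ fun t => 1 - ‖U (x₀ + s * t)‖ ^ 2 where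
  continuous := by
    have hU := h.continuous
    fun_prop
  zero := by
    rw [mul_zero, add_zero]
    linarith
  mem_Ioo t ht := by
    refine ⟨sub_pos.2 (hlt _), ?_⟩
    have hσ := right_ne_zero_of_mul (h.mul_inner_velocity_pos hκ hlt hx₀ hs ht).ne'
    have hintensity := h.intensity_eq (x := x₀ + s * t) fun y _ =>
      (one_sub_two_mul_norm_sq_pos hκ (U y)).ne'
    have hpos := mul_pos (mul_pos four_pos (sq_pos_of_ne_zero hσ))
      (one_sub_two_mul_norm_sq_pos hκ (U (x₀ + s * t)))
    rw [hintensity] at hpos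
    linarith [pos_of_mul_pos_right hpos (sq_nonneg _)]
  hasDerivAt t ht := by
    have hσ := h.mul_inner_velocity_pos hκ hlt hx₀ hs ht
    refine (((h.hasDerivAt_norm_sq (one_sub_two_mul_norm_sq_pos hκ _).ne').comp t
      (((hasDerivAt_id t).const_mul s).const_add x₀)).const_sub 1).congr_deriv ?_
    have hsq := h.sq_two_mul_inner_velocity hκ (x₀ + s * t)
    have hη := sub_nonneg.2 (hlt (x₀ + s * t)).le
    have hroot : 2 * (s * ⟪U (x₀ + s * t), velocity κ (U (x₀ + s * t)) (F (x₀ + s * t))⟫_ℝ)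
        = (1 - ‖U (x₀ + s * t)‖ ^ 2) * √(ratio c κ (1 - ‖U (x₀ + s * t)‖ ^ 2)) := by
      rw [← Real.sqrt_sq hη, ← Real.sqrt_mul (sq_nonneg _), Real.sqrt_sq hη, ← hsq,
        mul_left_comm, ← Real.sqrt_sq (by linarith : 0 ≤ s * (2 * _)), mul_pow s, hs, one_mul]
    simp only [id, mul_one]
    linarith

theorem exists_norm_sq_eq_one_sub_eta (h : IsFluxSolution c κ U F g) (hκ : κ ≤ 0)
    (hc : c ^ 2 < 2) (hx : ‖U x‖ ^ 2 ≠ 1) :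
    ∃ x₀, ∀ y, ‖U y‖ ^ 2 = 1 - eta c κ (y - x₀) := by
  obtain ⟨x₀, hx₀, hmax⟩ := h.exists_forall_sq_le hx
  obtain ⟨hcenter, hzero⟩ := h.two_mul_norm_sq_eq_of_forall_sq_le hκ hx₀ hmax
  have hlt := h.norm_sq_lt_one hκ (x₀ := x₀) (by linarith)
  refine ⟨x₀, fun y => ?_⟩
  rcases le_total x₀ y with hy | hy
  · rw [(h.halfProfile hκ hlt hzero hcenter (one_pow 2)).eta_eq hκ hc,
      abs_of_nonneg (sub_nonneg.2 hy)]
    ring_nf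
  · rw [(h.halfProfile hκ hlt hzero hcenter neg_one_sq).eta_eq hκ hc,
      abs_of_nonpos (sub_nonpos.2 hy)]
    ring_nf

end IsFluxSolution

end Intensity

section Phase

theorem eq_polar_mul {z : ℂ} (hz : z ≠ 0) (w : ℂ) :
    w = ((⟪z, w⟫_ℝ / ‖z‖ ^ 2 : ℝ) + Complex.I * (⟪Complex.I * z, w⟫_ℝ / ‖z‖ ^ 2 : ℝ)) * z := by
  have hnorm : ((‖z‖ : ℂ)) ^ 2 ≠ 0 := pow_ne_zero 2 (by exact_mod_cast norm_ne_zero_iff.2 hz)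
  have hmul : (‖z‖ : ℂ) ^ 2 * w
      = ((⟪z, w⟫_ℝ : ℂ) + Complex.I * (⟪Complex.I * z, w⟫_ℝ : ℂ)) * z := by
    rw [← Complex.conj_mul']
    apply Complex.ext <;>
      simp only [Complex.inner, map_mul, Complex.conj_I, Complex.mul_re, Complex.mul_im,
        Complex.neg_re, Complex.neg_im, Complex.I_re, Complex.I_im, Complex.conj_re,
        Complex.conj_im, Complex.add_re, Complex.add_im, Complex.ofReal_re, Complex.ofReal_im] <;>
      ring
  push_cast
  rw [mul_div_assoc', ← add_div, div_mul_eq_mul_div, ← hmul, mul_div_cancel_left₀ _ hnorm]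

theorem hasDerivAt_norm {E : Type*} [NormedAddCommGroup E] [InnerProductSpace ℝ E] {f : ℝ → E}
    {f' : E} {x : ℝ} (hf : HasDerivAt f f' x) (h₀ : f x ≠ 0) :
    HasDerivAt (fun y => ‖f y‖) (⟪f x, f'⟫_ℝ / ‖f x‖) x := by
  have hsqrt := hf.norm_sq.sqrt (pow_ne_zero 2 (norm_ne_zero_iff.2 h₀))
  simp only [Real.sqrt_sq (norm_nonneg _)] at hsqrt
  exact hsqrt.congr_deriv (mul_div_mul_left _ _ two_ne_zero)

theorem exists_eq_const_mul_of_hasDerivAt_mul {a f W : ℝ → ℂ} {s : Set ℝ} (hs : IsOpen s)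
    (hs' : IsPreconnected s) (hf : ∀ x ∈ s, HasDerivAt f (a x * f x) x)
    (hW : ∀ x ∈ s, HasDerivAt W (a x * W x) x) (hW₀ : ∀ x ∈ s, W x ≠ 0) :
    ∃ q, ∀ x ∈ s, f x = q * W x := by
  have hquot (x : ℝ) (hx : x ∈ s) : HasDerivAt (f / W) 0 x :=
    ((hf x hx).div (hW x hx) (hW₀ x hx)).congr_deriv (by ring)
  obtain ⟨q, hq⟩ := hs.exists_is_const_of_deriv_eq_zero hs'
    (fun x hx => (hquot x hx).differentiableAt.differentiableWithinAt)
    (fun x hx => (hquot x hx).deriv)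
  exact ⟨q, fun x hx => (div_eq_iff (hW₀ x hx)).1 (hq x hx)⟩

theorem exists_eq_exp_mul_norm_mul_exp {f f' : ℝ → ℂ} {θ : ℝ → ℝ} {s : Set ℝ} (hs : IsOpen s)
    (hs' : IsPreconnected s) (hne : s.Nonempty) (hf : ∀ x ∈ s, HasDerivAt f (f' x) x)
    (hf₀ : ∀ x ∈ s, f x ≠ 0)
    (hθ : ∀ x ∈ s, HasDerivAt θ (⟪Complex.I * f x, f' x⟫_ℝ / ‖f x‖ ^ 2) x) :
    ∃ φ : ℝ, ∀ x ∈ s,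
      f x = Complex.exp (Complex.I * φ) * (‖f x‖ * Complex.exp (Complex.I * θ x)) := by
  have hW₀ (x : ℝ) (hx : x ∈ s) : (‖f x‖ : ℂ) ≠ 0 := by
    exact_mod_cast norm_ne_zero_iff.2 (hf₀ x hx)
  obtain ⟨q, hq⟩ := exists_eq_const_mul_of_hasDerivAt_mul
    (W := fun x => ‖f x‖ * Complex.exp (Complex.I * θ x)) hs hs'
    (fun x hx => (hf x hx).congr_deriv (eq_polar_mul (hf₀ x hx) (f' x)))
    (fun x hx => ((hasDerivAt_norm (hf x hx) (hf₀ x hx)).ofReal_comp.mul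
      ((hθ x hx).ofReal_comp.const_mul Complex.I).cexp).congr_deriv (by
        have := hW₀ x hx
        push_cast
        field_simp))
    (fun x hx => mul_ne_zero (hW₀ x hx) (Complex.exp_ne_zero _))
  obtain ⟨x, hx⟩ := hne
  have hq₁ : ‖q‖ = 1 := by
    have hnorm := congrArg norm (hq x hx)
    rw [norm_mul, norm_mul, Complex.norm_real, norm_norm, Complex.norm_exp_I_mul_ofReal,
      mul_one] at hnorm
    exact mul_right_cancel₀ (norm_ne_zero_iff.2 (hf₀ x hx)) (hnorm.symm.trans (one_mul _).symm)
  refine ⟨Complex.arg q, fun y hy => ?_⟩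
  rw [mul_comm Complex.I (Complex.arg q : ℂ), ← one_mul (Complex.exp (_ * Complex.I)),
    ← Complex.ofReal_one, ← hq₁, Complex.norm_mul_exp_arg_mul_I]
  exact hq y hy

theorem eq_norm_smul_of_hasDerivAt {E : Type*} [NormedAddCommGroup E] [NormedSpace ℝ E]
    {f : ℝ → E} {v e : E} {x₀ : ℝ} (hf : HasDerivAt f v x₀) (h₀ : f x₀ = 0)
    (he : ∀ x, x₀ < x → f x = ‖f x‖ • e) : v = ‖v‖ • e := by
  have hslope : Tendsto (slope f x₀) (𝓝[>] x₀) (𝓝 v) :=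
    hf.tendsto_slope.mono_left (nhdsGT_le_nhdsNE x₀)
  refine tendsto_nhds_unique (hslope.congr' ?_) (hslope.norm.smul_const e)
  filter_upwards [self_mem_nhdsWithin] with x hx
  rw [slope_def_module, h₀, sub_zero, norm_smul, mul_smul, ← he x hx,
    Real.norm_of_nonneg (inv_pos.2 (sub_pos.2 hx)).le]

theorem exists_eq_exp_mul_ite_norm {f f' : ℝ → ℂ} {x₀ : ℝ} (hf : ∀ x, HasDerivAt f (f' x) x)
    (hf₀ : ∀ x, f x = 0 ↔ x = x₀) (hf' : f' x₀ ≠ 0) (hang : ∀ x, ⟪Complex.I * f x, f' x⟫_ℝ = 0) :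
    ∃ φ : ℝ, ∀ x, f x = Complex.exp (Complex.I * φ) * (if x₀ ≤ x then ‖f x‖ else -‖f x‖ : ℝ) := by
  have hray {s : Set ℝ} (hs : IsOpen s) (hs' : IsPreconnected s) (hne : s.Nonempty)
      (hx₀ : x₀ ∉ s) : ∃ φ : ℝ, ∀ x ∈ s, f x = ‖f x‖ • Complex.exp (Complex.I * φ) := by
    obtain ⟨φ, hφ⟩ := exists_eq_exp_mul_norm_mul_exp (θ := 0) hs hs' hne (fun x _ => hf x)
      (fun x hx => (hf₀ x).not.2 (ne_of_mem_of_not_mem hx hx₀)) (fun x _ => by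
        rw [hang, zero_div]
        exact hasDerivAt_const x 0)
    refine ⟨φ, fun x hx => (hφ x hx).trans ?_⟩
    simp [mul_comm]
  obtain ⟨φ, hφ⟩ := hray isOpen_Ioi isPreconnected_Ioi nonempty_Ioi self_notMem_Ioi
  obtain ⟨ψ, hψ⟩ := hray isOpen_Iio isPreconnected_Iio nonempty_Iio self_notMem_Iio
  have hright := eq_norm_smul_of_hasDerivAt (hf x₀) ((hf₀ x₀).2 rfl) hφ
  have hleft : -f' x₀ = ‖-f' x₀‖ • Complex.exp (Complex.I * ψ) := by
    refine eq_norm_smul_of_hasDerivAt (f := fun x => f (2 * x₀ - x)) (x₀ := x₀)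
      (HasDerivAt.comp_const_sub _ _ ?_) ?_ fun x hx => hψ _ ?_
    · rw [two_mul, add_sub_cancel_right]
      exact hf x₀
    · rw [two_mul, add_sub_cancel_right, hf₀]
    · exact mem_Iio.2 (by linarith)
  have hopp : Complex.exp (Complex.I * ψ) = -Complex.exp (Complex.I * φ) := by
    rw [norm_neg] at hleft
    refine smul_right_injective ℂ (norm_ne_zero_iff.2 hf') ?_
    simp only [smul_neg]
    rw [← hleft, ← hright]
  refine ⟨φ, fun x => ?_⟩
  rcases lt_trichotomy x x₀ with hx | rfl | hx
  · rw [if_neg hx.not_ge, Complex.ofReal_neg, mul_comm, neg_mul, ← mul_neg, ← hopp]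
    exact hψ x hx
  · simp [(hf₀ x).2 rfl]
  · rw [if_pos hx.le, mul_comm]
    exact hφ x hx

end Phase

section Soliton

theorem hasDerivAt_theta {c κ : ℝ} (hκ : κ ≤ 0) (hc : c ^ 2 < 2) (hcont : Continuous (eta c κ))
    (hc₀ : c ≠ 0) (x : ℝ) :
    HasDerivAt (theta c κ) (c / 2 * (eta c κ x / (1 - eta c κ x))) x := by
  have hcont' : Continuous fun y => eta c κ y / (1 - eta c κ y) :=
    hcont.div (continuous_const.sub hcont) fun y => by
      have hle := (eta_mem_Ic hκ hc y).2
      have := sq_pos_of_ne_zero hc₀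
      linarith
  exact (hcont'.integral_hasStrictDerivAt 0 x).hasDerivAt.const_mul _

namespace IsFluxSolution

variable {c κ x x₀ : ℝ} {U F g : ℝ → ℂ}

theorem exists_eq_gray_soliton (h : IsFluxSolution c κ U F g) (hκ : κ ≤ 0) (hc : c ^ 2 < 2)
    (hc₀ : c ≠ 0) (heta : ∀ y, ‖U y‖ ^ 2 = 1 - eta c κ (y - x₀)) :
    ∃ φ : ℝ, ∀ y, U y = Complex.exp (Complex.I * φ) * soliton c κ (y - x₀) := by
  have hd (y : ℝ) := (one_sub_two_mul_norm_sq_pos hκ (U y)).ne'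
  have hU₀ (y : ℝ) : U y ≠ 0 := fun hU₀ => by
    have hle := (eta_mem_Ic hκ hc (y - x₀)).2
    have hzero := heta y
    rw [hU₀, norm_zero] at hzero
    linarith [sq_pos_of_ne_zero hc₀]
  have hcont : Continuous (eta c κ) := by
    have heq : eta c κ = fun y => 1 - ‖U (y + x₀)‖ ^ 2 := by
      funext y
      rw [heta, add_sub_cancel_right, sub_sub_cancel]
    have hU := h.continuous
    rw [heq]
    fun_prop
  obtain ⟨φ, hφ⟩ := exists_eq_exp_mul_norm_mul_exp (θ := fun y => theta c κ (y - x₀)) isOpen_univ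
    isPreconnected_univ univ_nonempty (fun y _ => h.hasDerivAt (hd y)) (fun y _ => hU₀ y)
    (fun y _ => by
      rw [h.angular_eq fun y _ => hd y, mul_div_assoc, heta, sub_sub_cancel]
      exact (hasDerivAt_theta hκ hc hcont hc₀ _).comp_sub_const y x₀)
  refine ⟨φ, fun y => ?_⟩
  rw [soliton, if_neg hc₀, ← heta, Real.sqrt_sq (norm_nonneg _)]
  exact hφ y trivial

theorem exists_eq_black_soliton (h : IsFluxSolution 0 κ U F g) (hκ : κ ≤ 0)
    (heta : ∀ y, ‖U y‖ ^ 2 = 1 - eta 0 κ (y - x₀)) :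
    ∃ φ : ℝ, ∀ y, U y = Complex.exp (Complex.I * φ) * soliton 0 κ (y - x₀) := by
  have hd (y : ℝ) := (one_sub_two_mul_norm_sq_pos hκ (U y)).ne'
  have hU₀ (y : ℝ) : U y = 0 ↔ y = x₀ := by
    have hcenter := eta_eq_right_end_iff (c := 0) hκ (by norm_num) (x := y - x₀)
    rw [sub_eq_zero] at hcenter
    rw [← norm_eq_zero, ← sq_eq_zero_iff, heta, ← hcenter, sub_eq_zero, eq_comm]
    norm_num
  have hV₀ : velocity κ (U x₀) (F x₀) ≠ 0 := fun hV₀ => by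
    have henergy := h.energy_eq (x := x₀) fun y _ => hd y
    rw [hV₀, (hU₀ x₀).2 rfl, inner_zero_left, norm_zero] at henergy
    norm_num at henergy
  obtain ⟨φ, hφ⟩ := exists_eq_exp_mul_ite_norm (fun y => h.hasDerivAt (hd y)) hU₀ hV₀
    fun y => by rw [h.angular_eq fun y _ => hd y, zero_div, zero_mul]
  refine ⟨φ, fun y => (hφ y).trans ?_⟩
  simp only [soliton, if_true, ← heta, Real.sqrt_sq (norm_nonneg _), sub_nonneg,
    apply_ite Complex.ofReal]

theorem exists_eq_soliton (h : IsFluxSolution c κ U F g) (hκ : κ ≤ 0) (hc : c ^ 2 < 2)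
    (hx : ‖U x‖ ^ 2 ≠ 1) :
    ∃ x₀ φ : ℝ, ∀ y, U y = Complex.exp (Complex.I * φ) * soliton c κ (y - x₀) := by
  obtain ⟨x₀, heta⟩ := h.exists_norm_sq_eq_one_sub_eta hκ hc hx
  rcases eq_or_ne c 0 with rfl | hc₀
  · exact ⟨x₀, h.exists_eq_black_soliton hκ heta⟩
  · exact ⟨x₀, h.exists_eq_gray_soliton hκ hc hc₀ heta⟩

end IsFluxSolution

end Soliton

section Regions

variable {c κ : ℝ}

theorem abs_lt_sqrt_two_iff : |c| < √2 ↔ c ^ 2 < 2 := by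
  rw [← Real.sqrt_sq_eq_abs, Real.sqrt_lt_sqrt_iff (sq_nonneg c)]

theorem nonpos_and_sq_le_two_of_notMem (hreg : (|c|, κ) ∉ Dtilde ∪ Ccrit)
    (hprod : 0 ≤ (1 - 2 * κ) * (2 - c ^ 2)) : κ ≤ 0 ∧ c ^ 2 ≤ 2 := by
  have heq : |c| = √2 ↔ c ^ 2 = 2 := by
    rw [← Real.sqrt_sq_eq_abs, Real.sqrt_inj (sq_nonneg c) zero_le_two]
  have hgt : √2 < |c| ↔ 2 < c ^ 2 := by
    rw [← Real.sqrt_sq_eq_abs, Real.sqrt_lt_sqrt_iff zero_le_two]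
  simp only [Dtilde, Ccrit, D1, D3, Bminus, Bplus, mem_union, mem_ofPred_eq, abs_nonneg, true_and,
    abs_lt_sqrt_two_iff, heq, hgt, not_or, not_and, not_lt] at hreg
  obtain ⟨⟨⟨⟨hD1, hD3⟩, hBminus⟩, hBplus⟩, hκ⟩ := hreg
  rcases lt_or_gt_of_ne hκ with hκ | hκ
  · have hc : c ^ 2 ≤ 2 := sub_nonneg.1 (nonneg_of_mul_nonneg_right hprod (by linarith))
    refine ⟨not_lt.1 fun hpos => ?_, hc⟩
    rcases hc.lt_or_eq with hc | hc
    · exact (hD1 hc hpos).not_gt hκ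
    · exact (hBminus hc hpos).not_gt hκ
  · rcases lt_trichotomy (c ^ 2) 2 with hc | hc | hc
    · exact absurd hprod (mul_neg_of_neg_of_pos (by linarith) (by linarith)).not_ge
    · exact absurd hκ (hBplus hc).not_gt
    · exact absurd hκ (hD3 hc).not_gt

end Regions

end QGP

theorem theorem1p2_general (c κ : ℝ) (u : ℝ → ℂ)
    (hu : u ∈ QGP.EnergySpace) (hsol : QGP.IsWeakSolution c κ u)
    (hcκ : (|c|, κ) ∉ QGP.Dtilde ∪ QGP.Ccrit) :
    ∃ v : ℝ → ℂ, u =ᵐ[MeasureTheory.volume] v ∧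
      (((|c|, κ) ∈ QGP.D2 ∧
          Set.BijOn (QGP.G c κ) (QGP.Ic c) (Set.Ici 0) ∧
          ContDiff ℝ ∞ v ∧
          ∃ x₀ φ : ℝ, ∀ x, v x = Complex.exp (Complex.I * (φ : ℂ)) * QGP.soliton c κ (x - x₀)) ∨
        ∃ z : ℂ, ‖z‖ = 1 ∧ ∀ x, v x = z) := by
  obtain ⟨U, F, g, huU, h⟩ := QGP.exists_isFluxSolution hu hsol
  refine ⟨U, huU, ?_⟩
  by_cases hone : ∀ x, ‖U x‖ ^ 2 = 1
  · exact .inr (h.eq_const_of_norm_sq_eq_one (fun hκ => hcκ (.inr ⟨abs_nonneg c, hκ⟩)) hone)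
  have hprod : 0 ≤ (1 - 2 * κ) * (2 - c ^ 2) :=
    not_lt.1 fun hneg => hone (h.norm_sq_eq_one_of_neg hneg)
  push Not at hone
  obtain ⟨x, hx⟩ := hone
  obtain ⟨hκ, hc⟩ := QGP.nonpos_and_sq_le_two_of_notMem hcκ hprod
  obtain ⟨x₀, hx₀, hmax⟩ := h.exists_forall_sq_le hx
  have hcenter := (h.two_mul_norm_sq_eq_of_forall_sq_le hκ hx₀ hmax).1
  have hc' : c ^ 2 < 2 := hc.lt_of_ne fun hc => hx₀ (by linarith)
  exact .inl ⟨⟨abs_nonneg c, QGP.abs_lt_sqrt_two_iff.2 hc', hκ⟩, QGP.bijOn_G hκ hc',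
    h.contDiff hκ, h.exists_eq_soliton hκ hc' hx⟩

theorem theorem1p2 (c κ : ℝ) (hc : 0 ≤ c) (u : ℝ → ℂ)
    (hu : u ∈ QGP.EnergySpace) (hsol : QGP.IsWeakSolution c κ u)
    (hcκ : (c, κ) ∉ QGP.Dtilde ∪ QGP.Ccrit) :
    ∃ v : ℝ → ℂ, u =ᵐ[MeasureTheory.volume] v ∧
      (((c, κ) ∈ QGP.D2 ∧
          Set.BijOn (QGP.G c κ) (QGP.Ic c) (Set.Ici 0) ∧
          ContDiff ℝ ∞ v ∧
          ∃ x₀ φ : ℝ, ∀ x, v x = Complex.exp (Complex.I * (φ : ℂ)) * QGP.soliton c κ (x - x₀)) ∨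
        ∃ z : ℂ, ‖z‖ = 1 ∧ ∀ x, v x = z) := by
  simpa only [abs_of_nonneg hc] using
    theorem1p2_general c κ u hu hsol (by rwa [abs_of_nonneg hc])
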